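/- Conventions. A $k$-uniform hypergraph $H$ on a finite vertex set $V(H)$ is identified with its set of edges, which are $k$-element subsets of $V(H)$, and $|H|$ is the number of edges. For a vertex $v$, $d_H(v)$ is the number of edges of $H$ that contain $v$. $H$ has an $r$-regular subgraph if there are a set $F$ of edges of $H$ and a nonempty set $S$ of vertices such that every vertex of $S$ lies in exactly $r$ members of $F$ and every vertex outside $S$ lies in none. For integers $n,k,\ell$ put $$\alpha=\frac{3\cdot 2^{\ell}+4}{2^{\ell}(3\cdot 2^{\ell}+5)},\qquad D=n^{k-1-\alpha},\qquad \beta=k^{4k}\,n^{-\frac{1}{2^{\ell-1}(3\cdot 2^{\ell}+5)}}.$$ For an $n$-vertex $k$-uniform hypergraph $H$ let $$T=\{v\in V(H): d_H(v)\ge D\},\qquad H_1=\{e\in H: |e\cap T|=1\},$$ $$G=\{e\in H_1:\ \text{there is no } f\in H_1 \text{ with } f\neq e \text{ and } f\setminus T=e\setminus T\},\qquad G'=\{e\setminus T: e\in G\},$$ and for a vertex $v$ let $G_v=\{e\setminus\{v\}: v\in e\in G\}$. Theorem. Let $k,r,\ell$ be integers with $r\ge 1$, $\ell=\lceil\log_2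 r\rceil$ and $k\ge 2^{\ell}+3$. There exists an integer $n_k$, depending only on $k$, such that the following holds. If $n\ge n_k$ and $H$ is an $n$-vertex $k$-uniform hypergraph with no $r$-regular subgraph such that $$|H|\ \ge\ \binom{n-1}{k-1}-\frac{\beta\, n^{k-1}}{k^{4k}},$$ then there exists a vertex $v$ of $H$ with $$|G_v|\ \ge\ (1-\beta)\,|G'|.$$ -/

import Mathlib

/-! A hypergraph on the finite vertex set `V` is given by its set of edges
`H : Finset (Finset V)`; it is `k`-uniform when `(H : Set (Finset V)).Sized k`. -/

namespace RegularSubgraph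

variable {V : Type*} [Fintype V] [DecidableEq V]

/-- The degree of the vertex `v` in `H`. -/
def degree (H : Finset (Finset V)) (v : V) : ℕ := (H.filter fun e => v ∈ e).card

/-- `H` has an `r`-regular subgraph: some collection `F` of edges of `H` covers each vertex of
some nonempty set `S` exactly `r` times, and covers no other vertex. -/
def HasRegularSubgraph (H : Finset (Finset V)) (r : ℕ) : Prop :=
  ∃ F ⊆ H, ∃ S : Finset V, S.Nonempty ∧
    (∀ v ∈ S, degree F v = r) ∧ ∀ v ∉ S, degree F v = 0

/-- The (edges of the) link graph of the vertex `x` in `H`. -/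
def link (H : Finset (Finset V)) (x : V) : Finset (Finset V) :=
  (H.filter fun e => x ∈ e).image fun e => e \ {x}

/-- The set of vertices of `H` of degree at least `D`. -/
noncomputable def highDegreeSet (H : Finset (Finset V)) (D : ℝ) : Finset V := by
  classical exact Finset.univ.filter fun v => D ≤ (degree H v : ℝ)

/-- The edges of `H` that meet `T` in exactly one vertex. -/
def edgesMeetingOnce (H : Finset (Finset V)) (T : Finset V) : Finset (Finset V) :=
  H.filter fun e => (e ∩ T).card = 1

/-- The edges `e` of `H` that meet `T` in exactly one vertex and are the only such edge
with the trace `e \ T` outside `T`. -/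
def uniqueExtensionEdges (H : Finset (Finset V)) (T : Finset V) : Finset (Finset V) :=
  (edgesMeetingOnce H T).filter fun e => ¬ ∃ f ∈ edgesMeetingOnce H T, f ≠ e ∧ e \ T = f \ T

/-- The sets `e \ T`, for the edges `e` with unique extension. -/
def uniqueExtensionTraces (H : Finset (Finset V)) (T : Finset V) : Finset (Finset V) :=
  (uniqueExtensionEdges H T).image fun e => e \ T

/-- The exponent `α = (3·2^ℓ + 4) / (2^ℓ (3·2^ℓ + 5))`. -/
noncomputable def alpha (ℓ : ℕ) : ℝ := (3 * 2 ^ ℓ + 4) / (2 ^ ℓ * (3 * 2 ^ ℓ + 5))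

/-- The degree threshold `D = n^(k - 1 - α)`. -/
noncomputable def threshold (n k ℓ : ℕ) : ℝ := (n : ℝ) ^ ((k : ℝ) - 1 - alpha ℓ)

/-- `β = k^(4k) n^(-1 / (2^(ℓ-1) (3·2^ℓ + 5)))`. The exponent `ℓ - 1` is an integer. -/
noncomputable def beta (n k ℓ : ℕ) : ℝ :=
  (k : ℝ) ^ (4 * k) * (n : ℝ) ^ (-(1 / ((2 : ℝ) ^ ((ℓ : ℤ) - 1) * (3 * 2 ^ ℓ + 5))))

end RegularSubgraph

/-! Write `q = 2 ^ ℓ`, `n = |V|`, `δ = 1 / (q (3 q + 5))`, so that `α = 1 / q - δ` and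
`β = k ^ (4 k) n ^ (-2 δ)`, and let `T` be the set of vertices of degree at least
`D = n ^ (k - 1 - α)`. The deficit `a = n ^ (k - 1 - 2 δ)` is the unit in which all errors are
measured. Two constructions of regular subgraphs carry the proof.

* **Complementary pairs.** A dense `s`-uniform family contains `q` members whose complements in one
  common set are members too (`exists_complementary_pairs`). If all members extend to edges both by
  `X` and by `Y`, adding `X` to the members and `Y` to their complements gives an `r`-regular
  subgraph (`hasRegularSubgraph_of_common_extension`). Hence no two vertices have a dense common
  link.
* **Matchings.** More than `r ^ M * M!` perfect matchings with `M` edges on one vertex set contain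
  `r` which are edge-disjoint after deletion of common edges, as in the sunflower lemma
  (`hasRegularSubgraph_of_many_matchings`). So in a hypergraph without `r`-regular subgraph, the
  greedy choice of a matching gets stuck early (`exists_matching_with_few_extensions`): otherwise
  the matchings would far outnumber their vertex sets.

Applied to the edges avoiding `T`, whose degrees are less than `D`, the second construction bounds
their number by `5 k a`. This is where `k - 2 ≥ q + 1` and the exact value of `α` are needed:
a matching size `M` with `M ^ (q + 1)` at least `n ^ (1 + 2 δ)` has to satisfy `k M D = O(a)`.
Applied to the edges that meet `T` once, it produces a small set `T'` of vertices of `T` that meets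
all but `2 a` of them (`exists_colour_set`). Since two vertices of `T'` have few common link
members, all but `5 a` edges meeting `T` once have a unique extension, and thus the traces of the
unique-extension edges form an almost complete `(k - 1)`-uniform family, which is coloured by the
few vertices of `T'`.

If no vertex dominates, there are many pairs of traces with different colours. Splitting traces as
`A ∪ B` with `|A|, |B| > ℓ` and passing from `A ∪ B` to `A' ∪ B'` through `A ∪ B'` gives many
triples with `A ∪ B` of colour `x` and `A ∪ B'` of colour `y ≠ x`. For suitable `B`, `B'`, `x`, `y`
the sets `A` form a dense family that extends to edges by both `B ∪ {x}` and `B' ∪ {y}`,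
contrary to the first construction (`card_mul_le_of_coloring`).

All powers of `n` become integral powers of `z = n ^ (1 / (q (q + 1) (3 q + 5)))`. -/

namespace RegularSubgraph

open Finset

/-! ### Complementary pairs in dense uniform families -/

section

variable {V : Type*} [DecidableEq V]

theorem card_filter_not_disjoint_le (P : Finset (Finset V)) (W : Finset V) :
    #{e ∈ P | ¬ Disjoint e W} ≤ ∑ v ∈ W, degree P v := by
  calc #{e ∈ P | ¬ Disjoint e W} ≤ #(W.biUnion fun v => {e ∈ P | v ∈ e}) := by
        refine card_le_card fun e he => ?_
        obtain ⟨heP, hne⟩ := mem_filter.1 he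
        obtain ⟨v, hve, hvW⟩ := not_disjoint_iff.1 hne
        exact mem_biUnion.2 ⟨v, hvW, mem_filter.2 ⟨heP, hve⟩⟩
    _ ≤ ∑ v ∈ W, degree P v := card_biUnion_le

variable [Fintype V]

/-- A set `W` has codegree at most `n ^ (s - |W|)` in an `s`-uniform family. -/
theorem card_filter_superset_le {s : ℕ} {P : Finset (Finset V)} (hP : (P : Set (Finset V)).Sized s)
    (W : Finset V) : #{e ∈ P | W ⊆ e} ≤ Fintype.card V ^ (s - #W) := by
  calc #{e ∈ P | W ⊆ e} ≤ #(powersetCard (s - #W) (univ : Finset V)) := by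
        refine card_le_card_of_injOn (fun e => e \ W) (fun e he => ?_) (fun e he f hf hef => ?_)
        · simp only [coe_filter, Set.mem_ofPred_eq] at he
          rw [mem_coe, mem_powersetCard, card_sdiff_of_subset he.2, hP he.1]
          exact ⟨subset_univ _, rfl⟩
        · simp only [coe_filter, Set.mem_ofPred_eq] at he hf
          rw [← sdiff_union_of_subset he.2, ← sdiff_union_of_subset hf.2]
          exact congrArg (· ∪ W) hef
    _ ≤ Fintype.card V ^ (s - #W) := by
        rw [card_powersetCard]
        exact Nat.choose_le_pow _ _

theorem degree_le {s : ℕ} {P : Finset (Finset V)} (hP : (P : Set (Finset V)).Sized s)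
    (v : V) : degree P v ≤ Fintype.card V ^ (s - 1) := by
  simpa [degree] using card_filter_superset_le hP {v}

/-- Two vertices of a dense uniform family have links with a large intersection `L`. -/
theorem exists_dense_common_link {s : ℕ} {P : Finset (Finset V)}
    (hP : (P : Set (Finset V)).Sized (s + 1)) {p : ℝ} (hp : 0 < p)
    (hcard : p * (Fintype.card V : ℝ) ^ (s + 1) ≤ #P) (hdense : 4 ≤ p ^ 2 * Fintype.card V) :
    ∃ a b : V, a ≠ b ∧ ∃ L : Finset (Finset V), (L : Set (Finset V)).Sized s ∧
      (∀ g ∈ L, (a ∉ g ∧ insert a g ∈ P) ∧ (b ∉ g ∧ insert b g ∈ P)) ∧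
      p ^ 2 / 2 * (Fintype.card V : ℝ) ^ s ≤ #L := by
  set N := Fintype.card V with hN
  set S := powersetCard s (univ : Finset V) with hS
  have hScard : (#S : ℝ) ≤ (N : ℝ) ^ s := by
    rw [hS, card_powersetCard]
    exact_mod_cast Nat.choose_le_pow _ _
  have hN0 : (0 : ℝ) < N := by
    by_contra h
    have h0 : (N : ℝ) = 0 := le_antisymm (not_lt.1 h) (Nat.cast_nonneg _)
    rw [h0, mul_zero] at hdense
    linarith
  let L : V → V → Finset (Finset V) := fun a b =>
    {g ∈ S | (a ∉ g ∧ insert a g ∈ P) ∧ (b ∉ g ∧ insert b g ∈ P)}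
  obtain ⟨a, b, hab, hL⟩ : ∃ a b, a ≠ b ∧ p ^ 2 / 2 * (N : ℝ) ^ s ≤ #(L a b) := by
    by_contra! hcon
    let χ : V → Finset V → ℝ := fun a g => if a ∉ g ∧ insert a g ∈ P then 1 else 0
    have hsum : (#P : ℝ) ≤ ∑ g ∈ S, ∑ a, χ a g := by
      have hle : #P ≤ #{x ∈ S ×ˢ (univ : Finset V) | x.2 ∉ x.1 ∧ insert x.2 x.1 ∈ P} := by
        refine card_le_card_of_surjOn (fun x => insert x.2 x.1) fun e he => ?_
        have hcard : #e = s + 1 := hP he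
        obtain ⟨a, ha⟩ : e.Nonempty := card_pos.1 (by omega)
        refine ⟨(e.erase a, a), ?_, insert_erase ha⟩
        simp only [coe_filter, mem_product, Set.mem_ofPred_eq, mem_univ, and_true, hS,
          mem_powersetCard, subset_univ, true_and, card_erase_of_mem ha, hcard,
          notMem_erase, not_false_eq_true, insert_erase ha]
        exact ⟨by omega, he⟩
      have heq : (#{x ∈ S ×ˢ (univ : Finset V) | x.2 ∉ x.1 ∧ insert x.2 x.1 ∈ P} : ℝ)
          = ∑ g ∈ S, ∑ a, χ a g := by
        rw [card_filter, sum_product]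
        push_cast
        rfl
      rw [← heq]
      exact_mod_cast hle
    have hLχ : ∀ a b, ∑ g ∈ S, χ a g * χ b g = #(L a b) := by
      intro a b
      simp only [L, card_filter, χ]
      push_cast
      refine sum_congr rfl fun g _ => ?_
      split_ifs <;> simp_all
    have hcs : (∑ g ∈ S, ∑ a, χ a g) ^ 2 ≤ #S * ∑ a, ∑ b, (#(L a b) : ℝ) := by
      refine (sq_sum_le_card_mul_sum_sq).trans (le_of_eq ?_)
      congr 1
      simp_rw [← hLχ, sq, sum_mul_sum]
      rw [sum_comm]
      refine sum_congr rfl fun a _ => ?_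
      rw [sum_comm]
    have hub : ∑ a, ∑ b, (#(L a b) : ℝ)
        ≤ N * (N * (p ^ 2 / 2 * (N : ℝ) ^ s)) + N * (N : ℝ) ^ s := by
      have hpt : ∀ a b, (#(L a b) : ℝ)
          ≤ p ^ 2 / 2 * (N : ℝ) ^ s + if a = b then (N : ℝ) ^ s else 0 := by
        intro a b
        by_cases h : a = b
        · have : (#(L a b) : ℝ) ≤ #S := by exact_mod_cast card_filter_le _ _
          rw [if_pos h]
          have : 0 ≤ p ^ 2 / 2 * (N : ℝ) ^ s := by positivity
          linarith
        · rw [if_neg h, add_zero]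
          exact (hcon a b h).le
      refine (sum_le_sum fun a _ => sum_le_sum fun b _ => hpt a b).trans (le_of_eq ?_)
      simp [sum_add_distrib, ← hN]
    have hNs : (0 : ℝ) < (N : ℝ) ^ s := by positivity
    have hP2 : (p * (N : ℝ) ^ (s + 1)) ^ 2 ≤ (∑ g ∈ S, ∑ a, χ a g) ^ 2 :=
      pow_le_pow_left₀ (by positivity) (hcard.trans hsum) 2
    have hfin : (p * (N : ℝ) ^ (s + 1)) ^ 2
        ≤ (N : ℝ) ^ s * (N * (N * (p ^ 2 / 2 * (N : ℝ) ^ s)) + N * (N : ℝ) ^ s) := by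
      refine hP2.trans (hcs.trans ?_)
      exact mul_le_mul hScard hub
        (sum_nonneg fun _ _ => sum_nonneg fun _ _ => Nat.cast_nonneg _) (pow_nonneg hN0.le _)
    have hN2 : (0 : ℝ) < (N : ℝ) ^ s * (N : ℝ) ^ s * N := by positivity
    have h3 : (p ^ 2 * N / 2) * ((N : ℝ) ^ s * (N : ℝ) ^ s * N)
        ≤ 1 * ((N : ℝ) ^ s * (N : ℝ) ^ s * N) := by
      rw [pow_succ (N : ℝ)] at hfin
      linarith
    have h4 := le_of_mul_le_mul_right h3 hN2
    linarith
  exact ⟨a, b, hab, L a b, fun g hg => (mem_powersetCard.1 (mem_filter.1 hg).1).2,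
    fun g hg => (mem_filter.1 hg).2, hL⟩

/-- A dense enough uniform family contains `2 ^ ℓ` members `e` whose complements in a common
set `U` are members as well. The proof doubles the configuration: by Cauchy-Schwarz the links of
two vertices `a ≠ b` share a dense family, and each complementary pair `(e, U \ e)` in it yields the
two pairs in which `a` and `b` are distributed over `e` and `U \ e`. -/
theorem exists_complementary_pairs (ℓ s : ℕ) (hs : ℓ < s) (P : Finset (Finset V))
    (hP : (P : Set (Finset V)).Sized s) (p : ℝ) (hp : 0 < p)
    (hcard : p * (Fintype.card V : ℝ) ^ s ≤ #P)
    (hdense : (s + 1) * 16 ^ 2 ^ ℓ ≤ p ^ 2 ^ ℓ * Fintype.card V) :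
    ∃ U : Finset V, ∃ E ⊆ P, #E = 2 ^ ℓ ∧ ∀ e ∈ E, e ⊆ U ∧ U \ e ∈ P := by
  induction ℓ generalizing s P p with
  | zero =>
    set N := Fintype.card V with hN
    have hN0 : (0 : ℝ) < N := by
      by_contra h
      have h0 : (N : ℝ) = 0 := le_antisymm (not_lt.1 h) (Nat.cast_nonneg _)
      rw [h0] at hdense
      have : (0 : ℝ) < (s + 1) * 16 ^ 2 ^ 0 := by positivity
      linarith
    have hPpos : (0 : ℝ) < #P := lt_of_lt_of_le (by positivity) hcard
    obtain ⟨e, he⟩ := card_pos.1 (Nat.cast_pos.1 hPpos)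
    have hlt : #{f ∈ P | ¬ Disjoint f e} < #P := by
      have h1 : #{f ∈ P | ¬ Disjoint f e} ≤ s * N ^ (s - 1) := by
        refine (card_filter_not_disjoint_le P e).trans ?_
        refine (sum_le_card_nsmul _ _ _ fun v _ => degree_le hP v).trans ?_
        rw [hP he, smul_eq_mul]
      have h2 : (s * N ^ (s - 1) : ℝ) < #P := by
        refine lt_of_lt_of_le ?_ hcard
        obtain ⟨t, rfl⟩ : ∃ t, s = t + 1 := ⟨s - 1, by omega⟩
        simp only [pow_zero, pow_one, add_tsub_cancel_right] at hdense ⊢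
        have : (0 : ℝ) < (N : ℝ) ^ t := by positivity
        rw [pow_succ]
        push_cast at hdense ⊢
        nlinarith
      exact lt_of_le_of_lt h1 (by exact_mod_cast h2)
    obtain ⟨f, hfP, hf⟩ : ∃ f ∈ P, Disjoint f e := by
      by_contra! h
      rw [filter_true_of_mem h] at hlt
      exact lt_irrefl _ hlt
    refine ⟨e ∪ f, {e}, by simpa using he, by simp, ?_⟩
    simp only [mem_singleton, forall_eq]
    refine ⟨subset_union_left, ?_⟩
    rwa [union_sdiff_cancel_left hf.symm]
  | succ ℓ ih =>
    obtain ⟨s, rfl⟩ : ∃ t, s = t + 1 := ⟨s - 1, by omega⟩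
    have hN0 : (0 : ℝ) < Fintype.card V := by
      by_contra h
      have h0 : (Fintype.card V : ℝ) = 0 := le_antisymm (not_lt.1 h) (Nat.cast_nonneg _)
      rw [h0, mul_zero] at hdense
      have : (0 : ℝ) < ((s + 1 : ℕ) + 1) * 16 ^ 2 ^ (ℓ + 1) := by positivity
      linarith
    have hp1 : p ≤ 1 := by
      have h1 : (#P : ℝ) ≤ (Fintype.card V : ℝ) ^ (s + 1) := by
        have : P ⊆ powersetCard (s + 1) univ := fun e he =>
          mem_powersetCard.2 ⟨subset_univ _, hP he⟩
        have := card_le_card this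
        rw [card_powersetCard] at this
        exact_mod_cast this.trans (Nat.choose_le_pow _ _)
      have h2 : (0 : ℝ) < (Fintype.card V : ℝ) ^ (s + 1) := by positivity
      exact le_of_mul_le_mul_right (by linarith) h2
    -- `p ≤ 1` turns the hypothesis on `p ^ 2 ^ (ℓ + 1)` into one on `p ^ 2`
    obtain ⟨a, b, hab, L, hLS, hmem, hL⟩ := exists_dense_common_link hP hp hcard (by
      have h5 : p ^ 2 ^ (ℓ + 1) ≤ p ^ 2 :=
        pow_le_pow_of_le_one hp.le hp1 (by
          rw [pow_succ]; exact Nat.le_mul_of_pos_left _ (by positivity))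
      have h6 : (16 : ℝ) ≤ 16 ^ 2 ^ (ℓ + 1) := le_self_pow₀ (by norm_num) (by positivity)
      have h7 : (16 : ℝ) ≤ ((s + 1 : ℕ) + 1) * 16 ^ 2 ^ (ℓ + 1) := by
        have : (1 : ℝ) ≤ ((s + 1 : ℕ) + 1) := by
          push_cast
          have : (0 : ℝ) ≤ s := Nat.cast_nonneg _
          linarith
        nlinarith
      have h8 := mul_le_mul_of_nonneg_right h5 hN0.le
      linarith)
    obtain ⟨U, E, hEL, hEcard, hE⟩ := ih s (by omega) L hLS (p ^ 2 / 2) (by positivity) hL (by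
      have h1 : (16 : ℝ) ^ 2 ^ (ℓ + 1) = 16 ^ 2 ^ ℓ * 16 ^ 2 ^ ℓ := by
        rw [← pow_add]; congr 1; ring
      have h2 : (2 : ℝ) ^ 2 ^ ℓ ≤ 16 ^ 2 ^ ℓ := pow_le_pow_left₀ (by norm_num) (by norm_num) _
      have h3 : p ^ 2 ^ (ℓ + 1) = (p ^ 2) ^ 2 ^ ℓ := by
        rw [← pow_mul]; congr 1; ring
      have h4 : (0 : ℝ) < 2 ^ 2 ^ ℓ := by positivity
      have h5 : (0 : ℝ) ≤ (s + 1) * 16 ^ 2 ^ ℓ := by positivity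
      rw [div_pow, div_mul_eq_mul_div, le_div_iff₀ h4, ← h3]
      refine le_trans ?_ hdense
      rw [h1]
      push_cast
      calc ((s : ℝ) + 1) * 16 ^ 2 ^ ℓ * 2 ^ 2 ^ ℓ ≤ (s + 1) * 16 ^ 2 ^ ℓ * 16 ^ 2 ^ ℓ :=
            mul_le_mul_of_nonneg_left h2 h5
        _ ≤ (s + 1 + 1) * (16 ^ 2 ^ ℓ * 16 ^ 2 ^ ℓ) := by
            rw [mul_assoc]
            exact mul_le_mul_of_nonneg_right (by linarith) (by positivity))
    have haE : ∀ e ∈ E, a ∉ U ∧ b ∉ U := by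
      intro e he
      have h1 := hmem e (hEL he)
      have h2 := hmem _ (hE e he).2
      simp only [mem_sdiff, not_and, not_not] at h2
      exact ⟨fun h => h1.1.1 (h2.1.1 h), fun h => h1.2.1 (h2.2.1 h)⟩
    refine ⟨insert a (insert b U), E.image (insert a) ∪ E.image (insert b), ?_, ?_, ?_⟩
    · refine union_subset (image_subset_iff.2 fun e he => ?_) (image_subset_iff.2 fun e he => ?_)
      · exact (hmem e (hEL he)).1.2
      · exact (hmem e (hEL he)).2.2
    · rw [card_union_of_disjoint, card_image_of_injOn, card_image_of_injOn, hEcard]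
      · ring
      · intro e he f hf hef
        rw [← erase_insert (hmem e (hEL he)).2.1, ← erase_insert (hmem f (hEL hf)).2.1]
        exact congrArg (fun g => Finset.erase g b) hef
      · intro e he f hf hef
        rw [← erase_insert (hmem e (hEL he)).1.1, ← erase_insert (hmem f (hEL hf)).1.1]
        exact congrArg (fun g => Finset.erase g a) hef
      · rw [disjoint_left]
        intro x hx hx'
        obtain ⟨e, he, rfl⟩ := mem_image.1 hx
        obtain ⟨f, hf, hfe⟩ := mem_image.1 hx'
        have : a ∈ insert b f := hfe ▸ mem_insert_self a e
        rcases mem_insert.1 this with h | h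
        · exact hab h
        · exact (hmem f (hEL hf)).1.1 h
    · intro x hx
      rcases mem_union.1 hx with hx | hx
      · obtain ⟨e, he, rfl⟩ := mem_image.1 hx
        obtain ⟨haU, hbU⟩ := haE e he
        refine ⟨insert_subset_insert _ ((hE e he).1.trans (subset_insert _ _)), ?_⟩
        convert (hmem _ (hE e he).2).2.2 using 1
        have h2 := (hmem e (hEL he)).2.1
        ext v
        simp only [mem_sdiff, mem_insert]
        grind
      · obtain ⟨e, he, rfl⟩ := mem_image.1 hx
        obtain ⟨haU, hbU⟩ := haE e he
        refine ⟨insert_subset (mem_insert_of_mem (mem_insert_self _ _))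
          ((hE e he).1.trans ((subset_insert _ _).trans (subset_insert _ _))) , ?_⟩
        convert (hmem _ (hE e he).2).1.2 using 1
        have h2 := (hmem e (hEL he)).1.1
        ext v
        simp only [mem_sdiff, mem_insert]
        grind

/-- If every member of a dense uniform family `P` extends to an edge both by `X` and by `Y`, then
`r ≤ 2 ^ ℓ` complementary pairs `(e, U \ e)` of `P` yield the `r`-regular subgraph formed by the
edges `e ∪ X` and `(U \ e) ∪ Y`. -/
theorem hasRegularSubgraph_of_common_extension {ℓ s r : ℕ} (hs : ℓ < s) (hr : r ≤ 2 ^ ℓ)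
    {H P : Finset (Finset V)} (hP : (P : Set (Finset V)).Sized s) {X Y : Finset V}
    (hXY : Disjoint X Y) (hX : X.Nonempty)
    (hext : ∀ e ∈ P, Disjoint e X ∧ Disjoint e Y ∧ e ∪ X ∈ H ∧ e ∪ Y ∈ H)
    {p : ℝ} (hp : 0 < p) (hcard : p * (Fintype.card V : ℝ) ^ s ≤ #P)
    (hdense : (s + 1) * 16 ^ 2 ^ ℓ ≤ p ^ 2 ^ ℓ * Fintype.card V) :
    HasRegularSubgraph H r := by
  obtain ⟨U, E', hE'P, hE'card, hE'⟩ := exists_complementary_pairs ℓ s hs P hP p hp hcard hdense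
  obtain ⟨E, hEE', hEcard⟩ := exists_subset_card_eq (hr.trans hE'card.ge)
  have hE : ∀ e ∈ E, e ∈ P ∧ e ⊆ U ∧ U \ e ∈ P := fun e he =>
    ⟨hE'P (hEE' he), hE' e (hEE' he)⟩
  have hinj1 : Set.InjOn (fun e => e ∪ X) (E : Set (Finset V)) := by
    intro e he f hf hef
    have h1 := (hext e (hE e he).1).1
    have h2 := (hext f (hE f hf).1).1
    rw [← union_sdiff_cancel_right h1, ← union_sdiff_cancel_right h2]
    exact congrArg (· \ X) hef
  have hinj2 : Set.InjOn (fun e => (U \ e) ∪ Y) (E : Set (Finset V)) := by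
    intro e he f hf hef
    have h1 := (hext _ (hE e he).2.2).2.1
    have h2 := (hext _ (hE f hf).2.2).2.1
    have h3 : U \ e = U \ f := by
      rw [← union_sdiff_cancel_right h1, ← union_sdiff_cancel_right h2]
      exact congrArg (· \ Y) hef
    rw [← Finset.sdiff_sdiff_eq_self (hE e he).2.1, ← Finset.sdiff_sdiff_eq_self (hE f hf).2.1, h3]
  have hdisj : Disjoint (E.image fun e => e ∪ X) (E.image fun e => (U \ e) ∪ Y) := by
    rw [disjoint_left]
    intro g hg hg'
    obtain ⟨e, he, rfl⟩ := mem_image.1 hg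
    obtain ⟨f, hf, hfe⟩ := mem_image.1 hg'
    obtain ⟨x, hx⟩ := hX
    have : x ∈ (U \ f) ∪ Y := hfe ▸ mem_union_right e hx
    rcases mem_union.1 this with h | h
    · exact disjoint_left.1 (hext _ (hE f hf).2.2).1 h hx
    · exact disjoint_left.1 hXY hx h
  have hdeg : ∀ v, degree ((E.image fun e => e ∪ X) ∪ (E.image fun e => (U \ e) ∪ Y)) v
      = #{e ∈ E | v ∈ e ∪ X} + #{e ∈ E | v ∈ (U \ e) ∪ Y} := by
    intro v
    rw [degree, filter_union, card_union_of_disjoint (disjoint_filter_filter hdisj),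
      filter_image, filter_image, card_image_of_injOn, card_image_of_injOn]
    · exact hinj2.mono (coe_subset.2 (filter_subset _ _))
    · exact hinj1.mono (coe_subset.2 (filter_subset _ _))
  refine ⟨_, union_subset (image_subset_iff.2 fun e he => (hext e (hE e he).1).2.2.1)
    (image_subset_iff.2 fun e he => (hext _ (hE e he).2.2).2.2.2), U ∪ X ∪ Y,
    hX.mono (fun x hx => by simp [hx]), fun v hv => ?_, fun v hv => ?_⟩
  · rw [hdeg]
    by_cases hvX : v ∈ X
    · rw [filter_true_of_mem fun e _ => mem_union_right _ hvX, filter_false_of_mem, hEcard]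
      · simp
      · intro e he h
        rcases mem_union.1 h with h | h
        · exact disjoint_left.1 (hext _ (hE e he).2.2).1 h hvX
        · exact disjoint_left.1 hXY hvX h
    by_cases hvY : v ∈ Y
    · rw [add_comm, filter_true_of_mem fun e _ => mem_union_right _ hvY, filter_false_of_mem,
        hEcard]
      · simp
      · intro e he h
        rcases mem_union.1 h with h | h
        · exact disjoint_left.1 (hext _ (hE e he).1).2.1 h hvY
        · exact hvX h
    have hvU : v ∈ U := by
      simpa [hvX, hvY] using hv
    simp only [mem_union, hvX, hvY, or_false, mem_sdiff, hvU, true_and]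
    rw [card_filter_add_card_filter_not, hEcard]
  · simp only [mem_union, not_or] at hv
    rw [hdeg, filter_false_of_mem, filter_false_of_mem]
    · simp
    · intro e he h
      simp [hv] at h
    · intro e he h
      rcases mem_union.1 h with h | h
      · exact hv.1.1 ((hE e he).2.1 h)
      · exact hv.1.2 h

end

/-! ### Matchings with a common vertex set -/

section

variable {V : Type*}

/-- The matchings of size `M` in `E`: sets of `M` pairwise disjoint members of `E`. -/
noncomputable def matchings (E : Finset (Finset V)) (M : ℕ) : Finset (Finset (Finset V)) := by
  classical exact E.powerset.filter fun A => #A = M ∧ (A : Set (Finset V)).PairwiseDisjoint id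

theorem mem_matchings {E A : Finset (Finset V)} {M : ℕ} :
    A ∈ matchings E M ↔ A ⊆ E ∧ #A = M ∧ (A : Set (Finset V)).PairwiseDisjoint id := by
  simp [matchings]

variable [DecidableEq V]

theorem degree_eq_one_of_mem_biUnion {A : Finset (Finset V)}
    (hA : (A : Set (Finset V)).PairwiseDisjoint id) {v : V} (hv : v ∈ A.biUnion id) :
    degree A v = 1 := by
  obtain ⟨e, he, hve⟩ := mem_biUnion.1 hv
  refine card_eq_one.2 ⟨e, ?_⟩
  ext f
  simp only [mem_filter, mem_singleton]
  refine ⟨fun ⟨hf, hvf⟩ => ?_, ?_⟩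
  · by_contra hne
    exact disjoint_left.1 (hA hf he hne) hvf hve
  · rintro rfl
    exact ⟨he, hve⟩

/-- A sunflower-type bound: among more than `r ^ M * M!` perfect matchings of the same vertex set
there are `r` that become edge-disjoint once their common edges are deleted. -/
theorem hasRegularSubgraph_of_many_matchings {H : Finset (Finset V)} {r : ℕ}
    (hH : ∀ e ∈ H, e.Nonempty) (M : ℕ) (U : Finset V) (𝓐 : Finset (Finset (Finset V)))
    (h𝓐 : ∀ A ∈ 𝓐, A ∈ matchings H M ∧ A.biUnion id = U) (hcard : r ^ M * M.factorial < #𝓐) :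
    HasRegularSubgraph H r := by
  induction M generalizing U 𝓐 with
  | zero =>
    have : 𝓐 ⊆ {∅} := fun A hA =>
      mem_singleton.2 (card_eq_zero.1 (mem_matchings.1 (h𝓐 A hA).1).2.1)
    have := card_le_card this
    simp at hcard this
    omega
  | succ M ih =>
    classical
    -- a largest family of pairwise edge-disjoint matchings in `𝓐`
    obtain ⟨𝓑, h𝓑, hmax⟩ := exists_max_image
      (𝓐.powerset.filter fun 𝓑 : Finset (Finset (Finset V)) =>
        (𝓑 : Set (Finset (Finset V))).PairwiseDisjoint id) card
      ⟨∅, by simp⟩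
    simp only [mem_filter, mem_powerset] at h𝓑 hmax
    by_cases hr : r ≤ #𝓑
    · obtain ⟨𝓒, h𝓒𝓑, h𝓒⟩ := exists_subset_card_eq hr
      have hdisj : (𝓒 : Set (Finset (Finset V))).PairwiseDisjoint id :=
        h𝓑.2.subset (coe_subset.2 h𝓒𝓑)
      have hdeg : ∀ v, degree (𝓒.biUnion id) v = ∑ A ∈ 𝓒, degree A v := by
        intro v
        rw [degree, filter_biUnion, card_biUnion]
        · rfl
        · exact fun A hA B hB hAB => disjoint_filter_filter (hdisj hA hB hAB)
      have hmem : ∀ A ∈ 𝓒, A ∈ matchings H (M + 1) ∧ A.biUnion id = U := fun A hA =>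
        h𝓐 A (h𝓑.1 (h𝓒𝓑 hA))
      refine ⟨𝓒.biUnion id, biUnion_subset.2 fun A hA => (mem_matchings.1 (hmem A hA).1).1, U,
        ?_, fun v hv => ?_, fun v hv => ?_⟩
      · obtain ⟨A, hA⟩ : 𝓐.Nonempty := card_pos.1 (by omega)
        obtain ⟨h1, h2⟩ := h𝓐 A hA
        obtain ⟨hAH, hAc, -⟩ := mem_matchings.1 h1
        obtain ⟨e, he⟩ : A.Nonempty := card_pos.1 (by omega)
        rw [← h2]
        exact (hH e (hAH he)).mono (subset_biUnion_of_mem id he)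
      · rw [hdeg, sum_congr rfl fun A hA => degree_eq_one_of_mem_biUnion
          (mem_matchings.1 (hmem A hA).1).2.2 ((hmem A hA).2.symm ▸ hv)]
        simpa using h𝓒
      · rw [hdeg]
        refine sum_eq_zero fun A hA => card_eq_zero.2 (filter_eq_empty_iff.2 fun e he hve => ?_)
        exact hv ((hmem A hA).2 ▸ mem_biUnion.2 ⟨e, he, hve⟩)
    · -- by maximality every member of `𝓐` shares an edge with `𝓑`, so some edge is very popular
      have hW : #(𝓑.biUnion id) ≤ r * (M + 1) := by
        refine card_biUnion_le.trans ((sum_le_card_nsmul _ _ (M + 1) fun A hA => ?_).trans ?_)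
        · exact (mem_matchings.1 (h𝓐 A (h𝓑.1 hA)).1).2.1.le
        · exact Nat.mul_le_mul_right _ (by omega)
      have hmeet : ∀ A ∈ 𝓐, ∃ e ∈ A, e ∈ 𝓑.biUnion id := by
        intro A hA
        by_contra! hcon
        have hAne : A.Nonempty := card_pos.1 (by
          rw [(mem_matchings.1 (h𝓐 A hA).1).2.1]; omega)
        have hA𝓑 : A ∉ 𝓑 := fun h => by
          obtain ⟨e, he⟩ := hAne
          exact hcon e he (mem_biUnion.2 ⟨A, h, he⟩)
        have := hmax (insert A 𝓑) ⟨insert_subset hA h𝓑.1, by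
          rw [coe_insert]
          refine h𝓑.2.insert fun B hB _ => disjoint_left.2 fun e he he' => ?_
          exact hcon e he (mem_biUnion.2 ⟨B, hB, he'⟩)⟩
        rw [card_insert_of_notMem hA𝓑] at this
        omega
      choose! g hgA hgW using hmeet
      obtain ⟨e, -, hfib⟩ := exists_lt_card_fiber_of_mul_lt_card_of_maps_to
        (n := r ^ M * M.factorial) hgW (by
          refine lt_of_le_of_lt (Nat.mul_le_mul_right _ hW) (lt_of_le_of_lt (le_of_eq ?_) hcard)
          rw [Nat.factorial_succ]
          ring)
      have hfmem : ∀ A ∈ {A ∈ 𝓐 | g A = e}, A ∈ 𝓐 ∧ e ∈ A := fun A hA =>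
        ⟨(mem_filter.1 hA).1, (mem_filter.1 hA).2 ▸ hgA A (mem_filter.1 hA).1⟩
      refine ih (U \ e) ({A ∈ 𝓐 | g A = e}.image fun A => A.erase e) ?_ ?_
      · intro B hB
        obtain ⟨A, hA, rfl⟩ := mem_image.1 hB
        obtain ⟨hA𝓐, heA⟩ := hfmem A hA
        obtain ⟨h1, h2⟩ := h𝓐 A hA𝓐
        obtain ⟨hAH, hAc, hAd⟩ := mem_matchings.1 h1
        refine ⟨mem_matchings.2 ⟨(erase_subset _ _).trans hAH, ?_,
          hAd.subset (coe_subset.2 (erase_subset _ _))⟩, ?_⟩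
        · rw [card_erase_of_mem heA, hAc]
          rfl
        · rw [← h2]
          ext v
          simp only [mem_biUnion, mem_erase, id, mem_sdiff]
          refine ⟨fun ⟨f, ⟨hfe, hfA⟩, hvf⟩ => ⟨⟨f, hfA, hvf⟩, fun hve => ?_⟩, ?_⟩
          · exact disjoint_left.1 (hAd hfA heA hfe) hvf hve
          · rintro ⟨⟨f, hfA, hvf⟩, hve⟩
            exact ⟨f, ⟨fun h => hve (h ▸ hvf), hfA⟩, hvf⟩
      · rwa [card_image_of_injOn]
        intro A hA B hB hAB
        rw [← insert_erase (hfmem A hA).2, ← insert_erase (hfmem B hB).2]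
        exact congrArg (insert e) hAB

/-- If every smaller matching has at least `a` extensions, then there are at least `a ^ M / M!`
matchings of size `M`. -/
theorem pow_le_factorial_mul_card_matchings {E : Finset (Finset V)} (hE : ∀ e ∈ E, e.Nonempty)
    {a : ℝ} (ha : 0 ≤ a) (M : ℕ)
    (hext : ∀ i < M, ∀ A ∈ matchings E i, a ≤ #{e ∈ E | Disjoint e (A.biUnion id)}) :
    a ^ M ≤ M.factorial * #(matchings E M) := by
  classical
  induction M with
  | zero =>
    have : (∅ : Finset (Finset V)) ∈ matchings E 0 := mem_matchings.2 (by simp)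
    simpa using Nat.one_le_iff_ne_zero.2 (card_ne_zero_of_mem this)
  | succ M ih =>
    have h1 := ih fun i hi => hext i (by omega)
    have h2 : #(matchings E M) • a ≤ #(matchings E (M + 1)) • ((M + 1 : ℕ) : ℝ) := by
      refine card_nsmul_le_card_nsmul (fun A B => A ⊆ B) (fun A hA => ?_) fun B hB => ?_
      · refine (hext M (by omega) A hA).trans ?_
        obtain ⟨hAE, hAc, hAd⟩ := mem_matchings.1 hA
        have hnot : ∀ e ∈ E, Disjoint e (A.biUnion id) → e ∉ A := by
          intro e he hd heA
          obtain ⟨v, hv⟩ := hE e he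
          exact disjoint_left.1 hd hv (mem_biUnion.2 ⟨e, heA, hv⟩)
        norm_cast
        refine card_le_card_of_injOn (fun e => insert e A) (fun e he => ?_)
          fun e he f hf hef => ?_
        · obtain ⟨heE, hed⟩ := mem_filter.1 (mem_coe.1 he)
          refine mem_coe.2 ((mem_bipartiteAbove _).2 ⟨mem_matchings.2
            ⟨insert_subset heE hAE, ?_, ?_⟩, subset_insert _ _⟩)
          · rw [card_insert_of_notMem (hnot e heE hed), hAc]
          · rw [coe_insert]
            exact hAd.insert fun f hf _ => hed.mono_right (subset_biUnion_of_mem id hf)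
        · obtain ⟨heE, hed⟩ := mem_filter.1 (mem_coe.1 he)
          have : e ∈ insert f A := by
            rw [← show insert e A = insert f A from hef]
            exact mem_insert_self _ _
          exact (mem_insert.1 this).resolve_right (hnot e heE hed)
      · norm_cast
        have hBc := (mem_matchings.1 hB).2.1
        calc _ ≤ #(powersetCard M B) := card_le_card fun A hA => by
              obtain ⟨h1, h2⟩ := (mem_bipartiteBelow _).1 hA
              exact mem_powersetCard.2 ⟨h2, (mem_matchings.1 h1).2.1⟩
          _ = M + 1 := by rw [card_powersetCard, hBc, Nat.choose_succ_self_right]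
    rw [nsmul_eq_mul, nsmul_eq_mul] at h2
    rw [pow_succ, Nat.factorial_succ]
    push_cast at h2 ⊢
    calc a ^ M * a ≤ M.factorial * #(matchings E M) * a := mul_le_mul_of_nonneg_right h1 ha
      _ = M.factorial * (#(matchings E M) * a) := by ring
      _ ≤ M.factorial * (#(matchings E (M + 1)) * (M + 1)) :=
          mul_le_mul_of_nonneg_left h2 (Nat.cast_nonneg _)
      _ = _ := by ring

theorem div_three_pow_le_factorial (M : ℕ) : ((M : ℝ) / 3) ^ M ≤ M.factorial := by
  have h1 := Real.pow_div_factorial_le_exp (x := M) (Nat.cast_nonneg M) M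
  have h2 : Real.exp M ≤ 3 ^ M := by
    rw [← Real.exp_one_pow M]
    exact pow_le_pow_left₀ (Real.exp_pos 1).le Real.exp_one_lt_three.le M
  have h3 : (0 : ℝ) < M.factorial := by exact_mod_cast M.factorial_pos
  rw [div_pow, div_le_iff₀ (by positivity)]
  rw [div_le_iff₀ h3] at h1
  nlinarith

theorem factorial_pow_le_factorial_mul (s M : ℕ) : M.factorial ^ s ≤ (s * M).factorial := by
  induction s with
  | zero => simp
  | succ s ih =>
    calc M.factorial ^ (s + 1) = M.factorial ^ s * M.factorial := pow_succ _ _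
      _ ≤ (s * M).factorial * M.factorial := Nat.mul_le_mul_right _ ih
      _ ≤ (s * M + M).factorial :=
          Nat.le_of_dvd (Nat.factorial_pos _) (Nat.factorial_mul_factorial_dvd_factorial_add _ _)
      _ = ((s + 1) * M).factorial := by rw [Nat.succ_mul]

theorem choose_mul_factorial_pow_le (n s M : ℕ) :
    n.choose (s * M) * M.factorial ^ s ≤ (n ^ s) ^ M := by
  calc n.choose (s * M) * M.factorial ^ s ≤ n.choose (s * M) * (s * M).factorial :=
        Nat.mul_le_mul_left _ (factorial_pow_le_factorial_mul s M)
    _ = n.descFactorial (s * M) := by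
        rw [Nat.descFactorial_eq_factorial_mul_choose, mul_comm]
    _ ≤ n ^ (s * M) := Nat.descFactorial_le_pow _ _
    _ = (n ^ s) ^ M := pow_mul _ _ _

/-- If the vertex sets of the `M`-matchings in `E` are so few that having `a` extensions at every
step would force more than `r ^ M * M!` matchings on a common vertex set, then in a hypergraph with
no `r`-regular subgraph some matching with fewer than `M` edges has fewer than `a` extensions. -/
theorem exists_matching_with_few_extensions {H E : Finset (Finset V)} {r k M : ℕ}
    (hreg : ¬ HasRegularSubgraph H r) (hEH : E ⊆ H) (hH : ∀ e ∈ H, e.Nonempty)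
    (hM : M ≠ 0) (hk : 2 ≤ k) (𝓤 : Finset (Finset V))
    (h𝓤 : ∀ A ∈ matchings E M, A.biUnion id ∈ 𝓤) {B : ℝ} (hB : 0 ≤ B)
    (hcard : (#𝓤 : ℝ) * (M.factorial : ℝ) ^ k ≤ B ^ M) {a : ℝ} (ha : 0 ≤ a)
    (hlt : B * r < a * ((M : ℝ) / 3) ^ (k - 2)) :
    ∃ A ⊆ E, #A < M ∧ (A : Set (Finset V)).PairwiseDisjoint id ∧
      (#{e ∈ E | Disjoint e (A.biUnion id)} : ℝ) < a := by
  classical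
  by_contra! hcon
  have h1 := pow_le_factorial_mul_card_matchings (fun e he => hH e (hEH he)) ha M
    fun i hi A hA => by
      obtain ⟨h1, h2, h3⟩ := mem_matchings.1 hA
      exact hcon A h1 (h2 ▸ hi) h3
  have h2 : #(matchings E M) ≤ #𝓤 * (r ^ M * M.factorial) := by
    by_contra! h
    obtain ⟨U, -, hU⟩ := exists_lt_card_fiber_of_mul_lt_card_of_maps_to h𝓤 h
    refine hreg (hasRegularSubgraph_of_many_matchings hH M U _ (fun A hA => ?_) hU)
    obtain ⟨h3, h4⟩ := mem_filter.1 hA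
    obtain ⟨h5, h6⟩ := mem_matchings.1 h3
    exact ⟨mem_matchings.2 ⟨h5.trans hEH, h6⟩, h4⟩
  have h2' : (#(matchings E M) : ℝ) ≤ #𝓤 * (r ^ M * M.factorial) := by exact_mod_cast h2
  have hf : (0 : ℝ) < M.factorial := by exact_mod_cast M.factorial_pos
  obtain ⟨j, rfl⟩ : ∃ j, k = j + 2 := ⟨k - 2, by omega⟩
  rw [Nat.add_sub_cancel] at hlt
  have h3 : a ^ M * (M.factorial : ℝ) ^ j ≤ (B * r) ^ M := by
    have h4 : a ^ M ≤ M.factorial * (#𝓤 * (r ^ M * M.factorial)) :=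
      h1.trans (mul_le_mul_of_nonneg_left h2' hf.le)
    calc a ^ M * (M.factorial : ℝ) ^ j
        ≤ M.factorial * (#𝓤 * (r ^ M * M.factorial)) * (M.factorial : ℝ) ^ j :=
          mul_le_mul_of_nonneg_right h4 (by positivity)
      _ = (#𝓤 * (M.factorial : ℝ) ^ (j + 2)) * r ^ M := by ring
      _ ≤ B ^ M * r ^ M := mul_le_mul_of_nonneg_right hcard (by positivity)
      _ = (B * r) ^ M := (mul_pow _ _ _).symm
  have h4 : (a * ((M : ℝ) / 3) ^ j) ^ M ≤ a ^ M * (M.factorial : ℝ) ^ j := by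
    rw [mul_pow, ← pow_mul, mul_comm j M, pow_mul]
    exact mul_le_mul_of_nonneg_left
      (pow_le_pow_left₀ (by positivity) (div_three_pow_le_factorial M) j) (by positivity)
  have h5 := pow_lt_pow_left₀ hlt (by positivity) hM
  linarith

theorem card_biUnion_matching {k : ℕ} {A : Finset (Finset V)}
    (hA : (A : Set (Finset V)).PairwiseDisjoint id) (hk : ∀ e ∈ A, #e = k) :
    #(A.biUnion id) = k * #A := by
  rw [card_biUnion hA, mul_comm]
  exact sum_const_nat hk

theorem card_inter_of_mem_edgesMeetingOnce {H : Finset (Finset V)} {T e : Finset V}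
    (he : e ∈ edgesMeetingOnce H T) : #(e ∩ T) = 1 := (mem_filter.1 he).2

variable [Fintype V]

/-- A hypergraph of maximum degree at most `D` with no `r`-regular subgraph has few edges: a
matching with few extensions meets at most `k * M * D` edges. The number of vertex sets of `M`-matchings is
estimated with `B = n ^ k`. -/
theorem card_lt_of_degree_le {H E : Finset (Finset V)} {r k M : ℕ}
    (hreg : ¬ HasRegularSubgraph H r) (hEH : E ⊆ H) (hH : (H : Set (Finset V)).Sized k)
    (hk : 2 ≤ k) (hM : M ≠ 0) {D a : ℝ} (ha : 0 ≤ a)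
    (hD : ∀ e ∈ E, ∀ v ∈ e, (degree E v : ℝ) ≤ D)
    (hlt : (Fintype.card V : ℝ) ^ k * r < a * ((M : ℝ) / 3) ^ (k - 2)) (hD0 : 0 ≤ D) :
    (#E : ℝ) < a + k * M * D := by
  have hne : ∀ e ∈ H, e.Nonempty := fun e he => card_pos.1 (by have := hH he; omega)
  obtain ⟨A, hAE, hAM, hAd, hA⟩ := exists_matching_with_few_extensions hreg hEH hne hM hk
    (powersetCard (k * M) univ) (fun A hA => by
      obtain ⟨h1, h2, h3⟩ := mem_matchings.1 hA
      refine mem_powersetCard.2 ⟨subset_univ _, ?_⟩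
      rw [card_biUnion_matching h3 fun e he => hH (hEH (h1 he)), h2])
    (B := (Fintype.card V : ℝ) ^ k) (by positivity) (by
      rw [card_powersetCard]
      exact_mod_cast choose_mul_factorial_pow_le (Fintype.card V) k M) ha hlt
  have h1 : (#{e ∈ E | ¬ Disjoint e (A.biUnion id)} : ℝ) ≤ k * M * D := by
    calc (#{e ∈ E | ¬ Disjoint e (A.biUnion id)} : ℝ)
        ≤ ∑ v ∈ A.biUnion id, (degree E v : ℝ) := by
          exact_mod_cast card_filter_not_disjoint_le E _
      _ ≤ #(A.biUnion id) • D := by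
          refine sum_le_card_nsmul _ _ _ fun v hv => ?_
          obtain ⟨e, he, hve⟩ := mem_biUnion.1 hv
          exact hD e (hAE he) v hve
      _ ≤ k * M * D := by
          rw [card_biUnion_matching hAd fun e he => hH (hEH (hAE he)), nsmul_eq_mul]
          push_cast
          have : (#A : ℝ) ≤ M := by exact_mod_cast hAM.le
          gcongr
  have h2 : (#{e ∈ E | Disjoint e (A.biUnion id)} : ℝ)
      + #{e ∈ E | ¬ Disjoint e (A.biUnion id)} = #E := by
    exact_mod_cast card_filter_add_card_filter_not (s := E) (fun e => Disjoint e (A.biUnion id))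
  linarith

/-- All but few of the edges that meet `T` once meet it in the same small set `T'`, the trace on `T`
of a matching with few extensions. A vertex set of an `M`-matching consists of `M` vertices of `T`
and `(k - 1) * M` others, which allows `B = |T| * n ^ (k - 1)`. -/
theorem exists_small_subset_meeting_most_edges {H : Finset (Finset V)} {T : Finset V} {r k M : ℕ}
    (hreg : ¬ HasRegularSubgraph H r) (hH : (H : Set (Finset V)).Sized k)
    (hk : 2 ≤ k) (hM : M ≠ 0) {a : ℝ} (ha : 0 ≤ a)
    (hlt : #T * (Fintype.card V : ℝ) ^ (k - 1) * r < a * ((M : ℝ) / 3) ^ (k - 2))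
    (hsmall : k * M * (#T * (Fintype.card V : ℝ) ^ (k - 2)) ≤ a) :
    ∃ T' ⊆ T, #T' ≤ M ∧ (#{e ∈ edgesMeetingOnce H T | Disjoint e T'} : ℝ) ≤ 2 * a := by
  set E := edgesMeetingOnce H T with hEdef
  have hEH : E ⊆ H := filter_subset _ _
  have hne : ∀ e ∈ H, e.Nonempty := fun e he => card_pos.1 (by have := hH he; omega)
  have hsd : ∀ e ∈ E, #(e \ T) = k - 1 := fun e he => by
    have h1 := card_sdiff_add_card_inter e T
    have h2 := card_inter_of_mem_edgesMeetingOnce he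
    have h3 := hH (hEH he)
    omega
  obtain ⟨A, hAE, hAM, hAd, hA⟩ := exists_matching_with_few_extensions hreg hEH hne hM hk
    (image₂ (· ∪ ·) (powersetCard M T) (powersetCard ((k - 1) * M) univ)) (fun A hA => by
      obtain ⟨h1, h2, h3⟩ := mem_matchings.1 hA
      refine mem_image₂.2 ⟨A.biUnion fun e => e ∩ T, ?_, A.biUnion fun e => e \ T, ?_, ?_⟩
      · refine mem_powersetCard.2 ⟨biUnion_subset.2 fun e _ => inter_subset_right, ?_⟩
        rw [card_biUnion, sum_const_nat (m := 1), h2, mul_one]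
        · exact fun e he => card_inter_of_mem_edgesMeetingOnce (h1 he)
        · exact fun e he f hf hef => (h3 he hf hef).mono inter_subset_left inter_subset_left
      · refine mem_powersetCard.2 ⟨subset_univ _, ?_⟩
        rw [card_biUnion, sum_const_nat (m := k - 1), h2, mul_comm]
        · exact fun e he => hsd e (h1 he)
        · exact fun e he f hf hef => (h3 he hf hef).mono sdiff_subset sdiff_subset
      · ext v
        simp only [mem_union, mem_biUnion, mem_inter, mem_sdiff, id]
        constructor
        · rintro (⟨e, he, hv, -⟩ | ⟨e, he, hv, -⟩) <;> exact ⟨e, he, hv⟩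
        · rintro ⟨e, he, hv⟩
          by_cases hvT : v ∈ T
          · exact Or.inl ⟨e, he, hv, hvT⟩
          · exact Or.inr ⟨e, he, hv, hvT⟩)
    (B := #T * (Fintype.card V : ℝ) ^ (k - 1)) (by positivity) (by
      have h1 : #(image₂ (· ∪ ·) (powersetCard M T) (powersetCard ((k - 1) * M) univ))
          ≤ (#T).choose M * (Fintype.card V).choose ((k - 1) * M) := by
        refine (card_image₂_le _ _ _).trans (le_of_eq ?_)
        rw [card_powersetCard, card_powersetCard, card_univ]
      have h2 := choose_mul_factorial_pow_le (#T) 1 M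
      have h3 := choose_mul_factorial_pow_le (Fintype.card V) (k - 1) M
      rw [one_mul, pow_one, pow_one] at h2
      have h4 : #(image₂ (· ∪ ·) (powersetCard M T) (powersetCard ((k - 1) * M) univ))
          * M.factorial ^ k ≤ (#T * Fintype.card V ^ (k - 1)) ^ M := by
        calc _ ≤ (#T).choose M * (Fintype.card V).choose ((k - 1) * M) * M.factorial ^ k :=
              Nat.mul_le_mul_right _ h1
          _ = ((#T).choose M * M.factorial) *
              ((Fintype.card V).choose ((k - 1) * M) * M.factorial ^ (k - 1)) := by
              obtain ⟨j, rfl⟩ : ∃ j, k = j + 1 := ⟨k - 1, by omega⟩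
              rw [Nat.add_sub_cancel, pow_succ]
              ring
          _ ≤ #T ^ M * (Fintype.card V ^ (k - 1)) ^ M := Nat.mul_le_mul h2 h3
          _ = _ := (mul_pow _ _ _).symm
      exact_mod_cast h4) ha hlt
  refine ⟨A.biUnion fun e => e ∩ T, biUnion_subset.2 fun e _ => inter_subset_right, ?_, ?_⟩
  · refine card_biUnion_le.trans ?_
    rw [sum_const_nat (m := 1) fun e he => card_inter_of_mem_edgesMeetingOnce (hAE he), mul_one]
    exact hAM.le
  -- an edge avoiding `T'` extends the matching unless it meets one of its vertices outside `T`
  have hsub : {e ∈ E | Disjoint e (A.biUnion fun e => e ∩ T)} ⊆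
      {e ∈ E | Disjoint e (A.biUnion id)} ∪
        ((A.biUnion fun e => e \ T) ×ˢ T).biUnion fun x => {e ∈ H | {x.1, x.2} ⊆ e} := by
    intro e he
    obtain ⟨heE, hed⟩ := mem_filter.1 he
    by_cases h : Disjoint e (A.biUnion id)
    · exact mem_union_left _ (mem_filter.2 ⟨heE, h⟩)
    · obtain ⟨v, hve, hvA⟩ := not_disjoint_iff.1 h
      obtain ⟨f, hf, hvf⟩ := mem_biUnion.1 hvA
      have hvT : v ∉ T := fun hvT => disjoint_left.1 hed hve
        (mem_biUnion.2 ⟨f, hf, mem_inter.2 ⟨hvf, hvT⟩⟩)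
      obtain ⟨x, hx⟩ := card_eq_one.1 (card_inter_of_mem_edgesMeetingOnce heE)
      have hx' : x ∈ e ∩ T := hx ▸ mem_singleton_self x
      refine mem_union_right _ (mem_biUnion.2 ⟨(v, x), mem_product.2 ⟨mem_biUnion.2
        ⟨f, hf, mem_sdiff.2 ⟨hvf, hvT⟩⟩, (mem_inter.1 hx').2⟩, mem_filter.2 ⟨hEH heE, ?_⟩⟩)
      simp [insert_subset_iff, hve, (mem_inter.1 hx').1]
  have hcount : (#(((A.biUnion fun e => e \ T) ×ˢ T).biUnion fun x => {e ∈ H | {x.1, x.2} ⊆ e}) : ℝ)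
      ≤ a := by
    refine le_trans ?_ hsmall
    have h1 : #(((A.biUnion fun e => e \ T) ×ˢ T).biUnion fun x => {e ∈ H | {x.1, x.2} ⊆ e})
        ≤ #((A.biUnion fun e => e \ T) ×ˢ T) * Fintype.card V ^ (k - 2) := by
      refine card_biUnion_le_card_mul _ _ _ fun x hx => ?_
      have hne : x.1 ≠ x.2 := by
        rintro h
        obtain ⟨h1, h2⟩ := mem_product.1 hx
        obtain ⟨e, -, he⟩ := mem_biUnion.1 h1
        exact (mem_sdiff.1 he).2 (h ▸ h2)
      have := card_filter_superset_le hH {x.1, x.2}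
      rwa [card_pair hne] at this
    have h2 : #(A.biUnion fun e => e \ T) ≤ k * M := by
      refine card_biUnion_le.trans ((sum_le_card_nsmul _ _ k fun e he => ?_).trans ?_)
      · rw [hsd e (hAE he)]; omega
      · rw [smul_eq_mul, mul_comm]
        exact Nat.mul_le_mul_left _ hAM.le
    rw [card_product] at h1
    have h3 : #(((A.biUnion fun e => e \ T) ×ˢ T).biUnion fun x => {e ∈ H | {x.1, x.2} ⊆ e})
        ≤ k * M * (#T * Fintype.card V ^ (k - 2)) := by
      refine h1.trans ?_
      rw [← mul_assoc]
      gcongr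
    exact_mod_cast h3
  have h1 : (#{e ∈ E | Disjoint e (A.biUnion fun e => e ∩ T)} : ℝ)
      ≤ #{e ∈ E | Disjoint e (A.biUnion id)} +
        #(((A.biUnion fun e => e \ T) ×ˢ T).biUnion fun x => {e ∈ H | {x.1, x.2} ⊆ e}) := by
    exact_mod_cast (card_le_card hsub).trans (card_union_le _ _)
  linarith

end

/-! ### Edges meeting a vertex set once -/

section

variable {V : Type*} [DecidableEq V]

theorem exists_mem_eq_insert_sdiff {H : Finset (Finset V)} {T e : Finset V}
    (he : e ∈ edgesMeetingOnce H T) :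
    ∃ x ∈ T, x ∈ e ∧ e = insert x (e \ T) ∧ ∀ y ∈ e, y ∈ T → y = x := by
  obtain ⟨x, hx⟩ := card_eq_one.1 (card_inter_of_mem_edgesMeetingOnce he)
  have hx' : x ∈ e ∩ T := hx ▸ mem_singleton_self x
  refine ⟨x, (mem_inter.1 hx').2, (mem_inter.1 hx').1, ?_, fun y hy hyT => ?_⟩
  · rw [insert_eq, ← hx, inter_comm, union_comm, inter_comm]
    exact (sdiff_union_inter e T).symm
  · exact mem_singleton.1 (hx ▸ mem_inter.2 ⟨hy, hyT⟩)

theorem injOn_sdiff_uniqueExtensionEdges (H : Finset (Finset V)) (T : Finset V) :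
    Set.InjOn (fun e => e \ T) (uniqueExtensionEdges H T : Set (Finset V)) := by
  intro e he f hf hef
  by_contra hne
  exact (mem_filter.1 he).2 ⟨f, (mem_filter.1 hf).1, fun h => hne h.symm, hef⟩

theorem card_uniqueExtensionTraces (H : Finset (Finset V)) (T : Finset V) :
    #(uniqueExtensionTraces H T) = #(uniqueExtensionEdges H T) :=
  card_image_of_injOn (injOn_sdiff_uniqueExtensionEdges H T)

theorem card_link (H : Finset (Finset V)) (v : V) : #(link H v) = degree H v := by
  refine card_image_of_injOn fun e he f hf hef => ?_
  have he' : v ∈ e := (mem_filter.1 (mem_coe.1 he)).2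
  have hf' : v ∈ f := (mem_filter.1 (mem_coe.1 hf)).2
  rw [← insert_erase he', ← insert_erase hf', ← sdiff_singleton_eq_erase,
    ← sdiff_singleton_eq_erase]
  exact congrArg (insert v) hef

theorem card_sdiff_of_mem_edgesMeetingOnce {H : Finset (Finset V)} {k : ℕ}
    (hH : (H : Set (Finset V)).Sized k) {T e : Finset V} (he : e ∈ edgesMeetingOnce H T) :
    #(e \ T) = k - 1 := by
  have h1 := card_sdiff_add_card_inter e T
  have h2 := card_inter_of_mem_edgesMeetingOnce he
  have h3 := hH (mem_filter.1 he).1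
  omega

theorem sum_degree_eq_sum_card_inter (H : Finset (Finset V)) (T : Finset V) :
    ∑ x ∈ T, degree H x = ∑ e ∈ H, #(e ∩ T) := by
  have := sum_card_bipartiteAbove_eq_sum_card_bipartiteBelow (s := T) (t := H)
    fun x e => x ∈ e
  refine this.trans (sum_congr rfl fun e _ => congrArg card ?_)
  ext x
  simp [and_comm]

variable [Fintype V]

theorem card_uniqueExtensionEdges_le {H : Finset (Finset V)} {k : ℕ}
    (hH : (H : Set (Finset V)).Sized k) (T : Finset V) :
    #(uniqueExtensionEdges H T) ≤ Fintype.card V ^ (k - 1) := by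
  rw [← card_uniqueExtensionTraces]
  have : uniqueExtensionTraces H T ⊆ powersetCard (k - 1) univ := image_subset_iff.2 fun e he =>
    mem_powersetCard.2 ⟨subset_univ _,
      card_sdiff_of_mem_edgesMeetingOnce hH (mem_filter.1 he).1⟩
  refine (card_le_card this).trans ?_
  rw [card_powersetCard]
  exact Nat.choose_le_pow _ _

theorem card_filter_two_le_card_inter_le {H : Finset (Finset V)} {k : ℕ}
    (hH : (H : Set (Finset V)).Sized k) (T : Finset V) :
    #{e ∈ H | 2 ≤ #(e ∩ T)} ≤ #T ^ 2 * Fintype.card V ^ (k - 2) := by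
  calc #{e ∈ H | 2 ≤ #(e ∩ T)} ≤ #(T.offDiag.biUnion fun x => {e ∈ H | {x.1, x.2} ⊆ e}) := by
        refine card_le_card fun e he => ?_
        obtain ⟨heH, he2⟩ := mem_filter.1 he
        obtain ⟨x, hx, y, hy, hxy⟩ := one_lt_card.1 he2
        rw [mem_inter] at hx hy
        refine mem_biUnion.2 ⟨(x, y), mem_offDiag.2 ⟨hx.2, hy.2, hxy⟩, mem_filter.2 ⟨heH, ?_⟩⟩
        simp [insert_subset_iff, hx.1, hy.1]
    _ ≤ #T.offDiag * Fintype.card V ^ (k - 2) := by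
        refine card_biUnion_le_card_mul _ _ _ fun x hx => ?_
        have := card_filter_superset_le hH {x.1, x.2}
        rwa [card_pair (mem_offDiag.1 hx).2.2] at this
    _ ≤ #T ^ 2 * Fintype.card V ^ (k - 2) := by
        refine Nat.mul_le_mul_right _ ?_
        rw [offDiag_card, sq]
        exact Nat.sub_le _ _

/-- Edges that meet `T` at least twice contribute little to the sum of the degrees over `T`. -/
theorem sum_degree_le {H : Finset (Finset V)} {k : ℕ}
    (hH : (H : Set (Finset V)).Sized k) (T : Finset V) :
    ∑ x ∈ T, degree H x
      ≤ #(edgesMeetingOnce H T) + k * (#T ^ 2 * Fintype.card V ^ (k - 2)) := by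
  rw [sum_degree_eq_sum_card_inter]
  calc ∑ e ∈ H, #(e ∩ T)
      ≤ ∑ e ∈ H, ((if #(e ∩ T) = 1 then 1 else 0) + if 2 ≤ #(e ∩ T) then k else 0) := by
        refine sum_le_sum fun e he => ?_
        have : #(e ∩ T) ≤ k := (card_le_card inter_subset_left).trans (hH he).le
        split_ifs <;> omega
    _ = #(edgesMeetingOnce H T) + k * #{e ∈ H | 2 ≤ #(e ∩ T)} := by
        rw [sum_add_distrib, ← card_filter, ← sum_filter, sum_const, smul_eq_mul, mul_comm k]
        rfl
    _ ≤ _ := by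
        gcongr
        exact card_filter_two_le_card_inter_le hH T

theorem card_le_card_disjoint_add {H : Finset (Finset V)} {k : ℕ}
    (hH : (H : Set (Finset V)).Sized k) (T : Finset V) :
    #H ≤ #{e ∈ H | Disjoint e T} + #(edgesMeetingOnce H T)
      + #T ^ 2 * Fintype.card V ^ (k - 2) := by
  refine le_trans ?_ (Nat.add_le_add_left (card_filter_two_le_card_inter_le hH T) _)
  calc #H ≤ #({e ∈ H | Disjoint e T} ∪ edgesMeetingOnce H T ∪ {e ∈ H | 2 ≤ #(e ∩ T)}) := by
        refine card_le_card fun e he => ?_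
        simp only [edgesMeetingOnce, mem_union, mem_filter, he, true_and,
          disjoint_iff_inter_eq_empty, ← card_eq_zero]
        omega
    _ ≤ _ := (card_union_le _ _).trans (Nat.add_le_add_right (card_union_le _ _) _)

/-- Few edges meeting `T` once share their trace with another such edge: two distinct vertices have
few common link members, so only few traces extend to two edges by vertices of `T'`, and the edges
meeting `T'` whose trace does not are outnumbered by the edges avoiding `T'`. -/
theorem card_edgesMeetingOnce_le {H : Finset (Finset V)} {r k ℓ : ℕ}
    (hreg : ¬ HasRegularSubgraph H r) (hH : (H : Set (Finset V)).Sized k) (hℓ : ℓ < k - 1)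
    (hr : r ≤ 2 ^ ℓ) {p : ℝ} (hp : 0 < p) (hdense : k * 16 ^ 2 ^ ℓ ≤ p ^ 2 ^ ℓ * Fintype.card V)
    {T T' : Finset V} (hTT : T' ⊆ T) {b : ℝ}
    (hb : (#{e ∈ edgesMeetingOnce H T | Disjoint e T'} : ℝ) ≤ b) :
    (#(edgesMeetingOnce H T) : ℝ) ≤ #(uniqueExtensionEdges H T) + 2 * b
      + #T' ^ 2 * (p * (Fintype.card V : ℝ) ^ (k - 1)) := by
  classical
  set E := edgesMeetingOnce H T with hE
  let N : V → V → Finset (Finset V) := fun x y =>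
    {g ∈ powersetCard (k - 1) univ | x ∉ g ∧ y ∉ g ∧ insert x g ∈ H ∧ insert y g ∈ H}
  have hN : ∀ x y, x ≠ y → (#(N x y) : ℝ) ≤ p * (Fintype.card V : ℝ) ^ (k - 1) := by
    intro x y hxy
    by_contra! hlt
    refine hreg (hasRegularSubgraph_of_common_extension hℓ hr (P := N x y)
      (fun g hg => (mem_powersetCard.1 (mem_filter.1 hg).1).2) (X := {x}) (Y := {y})
      (by simpa using hxy) (singleton_nonempty x) (fun g hg => ?_) hp hlt.le ?_)
    · obtain ⟨-, h1, h2, h3, h4⟩ := mem_filter.1 hg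
      simpa [h1, h2, union_comm g, ← insert_eq] using ⟨h3, h4⟩
    · refine le_trans (le_of_eq ?_) hdense
      rw [Nat.cast_sub (by omega)]
      simp
  set Z₁ := {e ∈ E | Disjoint e T'} with hZ₁
  set Z₃ := T'.offDiag.biUnion fun x => (N x.1 x.2).image (insert x.1) with hZ₃
  set Z := {e ∈ E | ∃ f ∈ E, f ≠ e ∧ e \ T = f \ T} with hZ
  have hkey : ∀ e ∈ E, ∀ f ∈ E, f ≠ e → e \ T = f \ T → ¬ Disjoint e T' → ¬ Disjoint f T' →
      e ∈ Z₃ := by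
    intro e he f hf hfe hef heT hfT
    obtain ⟨x, hxT, hxe, hex, hx⟩ := exists_mem_eq_insert_sdiff he
    obtain ⟨y, hyT, hyf, hfy, hy⟩ := exists_mem_eq_insert_sdiff hf
    obtain ⟨x', hx'e, hx'T⟩ := not_disjoint_iff.1 heT
    obtain ⟨y', hy'f, hy'T⟩ := not_disjoint_iff.1 hfT
    obtain rfl := hx x' hx'e (hTT hx'T)
    obtain rfl := hy y' hy'f (hTT hy'T)
    have hxy : x' ≠ y' := by
      rintro rfl
      exact hfe (by rw [hfy, hex, hef])
    refine mem_biUnion.2 ⟨(x', y'), mem_offDiag.2 ⟨hx'T, hy'T, hxy⟩,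
      mem_image.2 ⟨e \ T, mem_filter.2 ⟨mem_powersetCard.2 ⟨subset_univ _,
        card_sdiff_of_mem_edgesMeetingOnce hH he⟩, ?_, ?_, ?_, ?_⟩, hex.symm⟩⟩
    · exact fun h => (mem_sdiff.1 h).2 hxT
    · exact fun h => (mem_sdiff.1 h).2 hyT
    · rw [← hex]
      exact (mem_filter.1 he).1
    · rw [hef, ← hfy]
      exact (mem_filter.1 hf).1
  have hZmem : ∀ e ∈ Z \ (Z₁ ∪ Z₃), ∃ f ∈ Z₁, f ≠ e ∧ e \ T = f \ T := by
    intro e he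
    obtain ⟨heZ, heZ'⟩ := mem_sdiff.1 he
    obtain ⟨heE, f, hfE, hfe, hef⟩ := mem_filter.1 heZ
    refine ⟨f, mem_filter.2 ⟨hfE, ?_⟩, hfe, hef⟩
    by_contra hfT
    refine heZ' (mem_union_right _ (hkey e heE f hfE hfe hef (fun h => ?_) hfT))
    exact heZ' (mem_union_left _ (mem_filter.2 ⟨heE, h⟩))
  choose! φ hφZ hφne hφ using hZmem
  have h2 : #(Z \ (Z₁ ∪ Z₃)) ≤ #Z₁ := by
    refine card_le_card_of_injOn φ (fun e he => hφZ e he) fun e he f hf hef => ?_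
    by_contra hne
    have hE' : ∀ e ∈ Z \ (Z₁ ∪ Z₃), e ∈ E ∧ ¬ Disjoint e T' := fun e he => by
      obtain ⟨heZ, heZ'⟩ := mem_sdiff.1 he
      have heE := (mem_filter.1 heZ).1
      exact ⟨heE, fun h => heZ' (mem_union_left _ (mem_filter.2 ⟨heE, h⟩))⟩
    refine (mem_sdiff.1 (mem_coe.1 he)).2 (mem_union_right _ ?_)
    exact hkey e (hE' e he).1 f (hE' f hf).1 (fun h => hne h.symm)
      ((hφ e he).trans ((congrArg (· \ T) hef).trans (hφ f hf).symm)) (hE' e he).2 (hE' f hf).2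
  have h3 : (#Z₃ : ℝ) ≤ #T' ^ 2 * (p * (Fintype.card V : ℝ) ^ (k - 1)) := by
    calc (#Z₃ : ℝ) ≤ ∑ x ∈ T'.offDiag, (#(N x.1 x.2) : ℝ) := by
          exact_mod_cast card_biUnion_le.trans (sum_le_sum fun _ _ => card_image_le)
      _ ≤ #T'.offDiag • (p * (Fintype.card V : ℝ) ^ (k - 1)) :=
          sum_le_card_nsmul _ _ _ fun x hx => hN _ _ (mem_offDiag.1 hx).2.2
      _ ≤ _ := by
          rw [nsmul_eq_mul]
          refine mul_le_mul_of_nonneg_right ?_ (by positivity)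
          rw [offDiag_card, sq]
          exact_mod_cast Nat.sub_le _ _
  have h4 : #Z ≤ #Z₁ + #Z₃ + #Z₁ := by
    calc #Z ≤ #(Z₁ ∪ Z₃ ∪ (Z \ (Z₁ ∪ Z₃))) := card_le_card fun e he => by
          rw [union_sdiff_self_eq_union]
          exact mem_union_right _ he
      _ ≤ #(Z₁ ∪ Z₃) + #(Z \ (Z₁ ∪ Z₃)) := card_union_le _ _
      _ ≤ _ := Nat.add_le_add (card_union_le _ _) h2
  have h5 : #Z + #(uniqueExtensionEdges H T) = #E := card_filter_add_card_filter_not _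
  have h4' : (#Z : ℝ) ≤ #Z₁ + #Z₃ + #Z₁ := by exact_mod_cast h4
  have h5' : (#Z : ℝ) + #(uniqueExtensionEdges H T) = #E := by exact_mod_cast h5
  linarith

end

/-! ### Colourings of nearly complete families -/

section

variable {V : Type*} [Fintype V]

theorem card_powersetCard_univ_le (s : ℕ) :
    #(powersetCard s (univ : Finset V)) ≤ Fintype.card V ^ s := by
  rw [card_powersetCard]
  exact Nat.choose_le_pow _ _

variable [DecidableEq V]

theorem card_filter_not_disjoint_product_le {s t : ℕ} (hs : s ≠ 0) (ht : t ≠ 0) :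
    #{x ∈ powersetCard s (univ : Finset V) ×ˢ powersetCard t (univ : Finset V) |
      ¬ Disjoint x.1 x.2} ≤ Fintype.card V ^ (s + t - 1) := by
  have hsized : ∀ s : ℕ, (powersetCard s (univ : Finset V) : Set (Finset V)).Sized s :=
    fun s e he => (mem_powersetCard.1 he).2
  calc _ ≤ #((univ : Finset V).biUnion fun v =>
          {e ∈ powersetCard s (univ : Finset V) | v ∈ e} ×ˢ
            {e ∈ powersetCard t (univ : Finset V) | v ∈ e}) := by
        refine card_le_card fun x hx => ?_
        obtain ⟨hx, hd⟩ := mem_filter.1 hx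
        obtain ⟨v, h1, h2⟩ := not_disjoint_iff.1 hd
        obtain ⟨h3, h4⟩ := mem_product.1 hx
        exact mem_biUnion.2 ⟨v, mem_univ v, mem_product.2
          ⟨mem_filter.2 ⟨h3, h1⟩, mem_filter.2 ⟨h4, h2⟩⟩⟩
    _ ≤ #(univ : Finset V) * (Fintype.card V ^ (s - 1) * Fintype.card V ^ (t - 1)) := by
        refine card_biUnion_le_card_mul _ _ _ fun v _ => ?_
        rw [card_product]
        exact Nat.mul_le_mul (degree_le (hsized s) v) (degree_le (hsized t) v)
    _ = Fintype.card V ^ (s + t - 1) := by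
        rw [card_univ, ← pow_add, ← pow_succ']
        congr 1
        omega

/-- Few triples `(A, B, B')` are such that `A ∪ B` and `A ∪ B'` have different colours. Here `Tr` is
a family of sets, each of which extends to an edge of `H` by its colour, a vertex of `T'`. -/
theorem card_bichromatic_triples_le {H Tr : Finset (Finset V)} {r ℓ s t : ℕ}
    (hreg : ¬ HasRegularSubgraph H r) (hTr : (Tr : Set (Finset V)).Sized (s + t))
    (hs : ℓ < s) (ht : t ≠ 0) (hr : r ≤ 2 ^ ℓ) {p : ℝ} (hp : 0 < p)
    (hdense : (s + 1) * 16 ^ 2 ^ ℓ ≤ p ^ 2 ^ ℓ * Fintype.card V)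
    {T' : Finset V} {col : Finset V → V}
    (hcol : ∀ g ∈ Tr, col g ∈ T' ∧ insert (col g) g ∈ H ∧ Disjoint g T') :
    (#{x ∈ powersetCard s (univ : Finset V) ×ˢ
        (powersetCard t (univ : Finset V) ×ˢ powersetCard t (univ : Finset V)) |
        x.1 ∪ x.2.1 ∈ Tr ∧ x.1 ∪ x.2.2 ∈ Tr ∧ col (x.1 ∪ x.2.1) ≠ col (x.1 ∪ x.2.2)} : ℝ)
      ≤ (Fintype.card V : ℝ) ^ (2 * t) * (#T' ^ 2 * (p * (Fintype.card V : ℝ) ^ s))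
        + (Fintype.card V : ℝ) ^ (2 * t - 1) * (Fintype.card V : ℝ) ^ s := by
  set N := Fintype.card V with hN
  set 𝒜 := powersetCard s (univ : Finset V) with h𝒜
  set 𝓑 := powersetCard t (univ : Finset V) with h𝓑
  let Q : Finset V → Finset V → Finset (Finset V) := fun B B' =>
    {A ∈ 𝒜 | A ∪ B ∈ Tr ∧ A ∪ B' ∈ Tr ∧ col (A ∪ B) ≠ col (A ∪ B')}
  have hcardA : ∀ B B', (#(Q B B') : ℝ) ≤ (N : ℝ) ^ s := fun B B' => by
    exact_mod_cast (card_filter_le _ _).trans (card_powersetCard_univ_le s)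
  have hdisj : ∀ A ∈ 𝒜, ∀ B ∈ 𝓑, A ∪ B ∈ Tr → Disjoint A B := by
    intro A hA B hB hAB
    have h1 := card_union_add_card_inter A B
    rw [hTr hAB, (mem_powersetCard.1 hA).2, (mem_powersetCard.1 hB).2] at h1
    rw [disjoint_iff_inter_eq_empty, ← card_eq_zero]
    omega
  have hQ : ∀ B ∈ 𝓑, ∀ B' ∈ 𝓑, Disjoint B B' →
      (#(Q B B') : ℝ) ≤ #T' ^ 2 * (p * (N : ℝ) ^ s) := by
    intro B hB B' hB' hBB'
    let P : V → V → Finset (Finset V) := fun x y =>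
      {A ∈ Q B B' | col (A ∪ B) = x ∧ col (A ∪ B') = y}
    have hP : ∀ x ∈ T', ∀ y ∈ T', x ≠ y → (#(P x y) : ℝ) ≤ p * (N : ℝ) ^ s := by
      intro x hx y hy hxy
      by_contra! hlt
      have hmem : ∀ A ∈ P x y, A ∈ 𝒜 ∧ A ∪ B ∈ Tr ∧ A ∪ B' ∈ Tr ∧
          col (A ∪ B) = x ∧ col (A ∪ B') = y := by
        intro A hA
        obtain ⟨h1, h2, h3⟩ := mem_filter.1 hA
        obtain ⟨h4, h5, h6, -⟩ := mem_filter.1 h1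
        exact ⟨h4, h5, h6, h2, h3⟩
      have hout : ∀ A ∈ P x y, ∀ z ∈ T', z ∉ A ∧ z ∉ B ∧ z ∉ B' := by
        intro A hA z hz
        obtain ⟨-, h1, h2, -⟩ := hmem A hA
        have h3 := disjoint_right.1 (hcol _ h1).2.2 hz
        have h4 := disjoint_right.1 (hcol _ h2).2.2 hz
        simp only [mem_union, not_or] at h3 h4
        exact ⟨h3.1, h3.2, h4.2⟩
      obtain ⟨A₀, hA₀⟩ : (P x y).Nonempty := card_pos.1 (by
        have : (0 : ℝ) < #(P x y) := lt_of_le_of_lt (by positivity) hlt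
        exact_mod_cast this)
      refine hreg (hasRegularSubgraph_of_common_extension hs hr (P := P x y)
        (fun A hA => (mem_powersetCard.1 (hmem A hA).1).2) (X := insert x B) (Y := insert y B')
        ?_ (insert_nonempty _ _) (fun A hA => ?_) hp hlt.le hdense)
      · have h1 := hout A₀ hA₀ x hx
        have h2 := hout A₀ hA₀ y hy
        simp [disjoint_insert_left, disjoint_insert_right, hBB', hxy.symm, h1, h2]
      · obtain ⟨h1, h2, h3, h4, h5⟩ := hmem A hA
        have h6 := hout A hA x hx
        have h7 := hout A hA y hy
        have h8 := (hcol _ h2).2.1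
        have h9 := (hcol _ h3).2.1
        rw [h4] at h8
        rw [h5] at h9
        simp [disjoint_insert_right, h6, h7, hdisj A h1 B hB h2, hdisj A h1 B' hB' h3,
          union_insert, h8, h9]
    have hsub : Q B B' ⊆ T'.offDiag.biUnion fun x => P x.1 x.2 := by
      intro A hA
      obtain ⟨h1, h2, h3, h4⟩ := mem_filter.1 hA
      exact mem_biUnion.2 ⟨(col (A ∪ B), col (A ∪ B')), mem_offDiag.2
        ⟨(hcol _ h2).1, (hcol _ h3).1, h4⟩, mem_filter.2 ⟨hA, rfl, rfl⟩⟩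
    calc (#(Q B B') : ℝ) ≤ ∑ x ∈ T'.offDiag, (#(P x.1 x.2) : ℝ) := by
          exact_mod_cast (card_le_card hsub).trans card_biUnion_le
      _ ≤ #T'.offDiag • (p * (N : ℝ) ^ s) := by
          refine sum_le_card_nsmul _ _ _ fun x hx => ?_
          obtain ⟨h1, h2, h3⟩ := mem_offDiag.1 hx
          exact hP _ h1 _ h2 h3
      _ ≤ _ := by
          rw [nsmul_eq_mul]
          refine mul_le_mul_of_nonneg_right ?_ (by positivity)
          rw [offDiag_card, sq]
          exact_mod_cast Nat.sub_le _ _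
  have hsum : (#{x ∈ 𝒜 ×ˢ (𝓑 ×ˢ 𝓑) |
        x.1 ∪ x.2.1 ∈ Tr ∧ x.1 ∪ x.2.2 ∈ Tr ∧ col (x.1 ∪ x.2.1) ≠ col (x.1 ∪ x.2.2)} : ℝ)
      = ∑ y ∈ 𝓑 ×ˢ 𝓑, (#(Q y.1 y.2) : ℝ) := by
    rw [card_filter, sum_product_right]
    simp only [Q, card_filter]
    push_cast
    rfl
  rw [hsum, ← sum_filter_add_sum_filter_not (𝓑 ×ˢ 𝓑) fun y => Disjoint y.1 y.2]
  refine add_le_add ?_ ?_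
  · refine (sum_le_card_nsmul _ _ (#T' ^ 2 * (p * (N : ℝ) ^ s)) fun y hy => ?_).trans ?_
    · obtain ⟨h1, h2⟩ := mem_filter.1 hy
      obtain ⟨h3, h4⟩ := mem_product.1 h1
      exact hQ _ h3 _ h4 h2
    · rw [nsmul_eq_mul]
      refine mul_le_mul_of_nonneg_right ?_ (by positivity)
      have h1 : #{y ∈ 𝓑 ×ˢ 𝓑 | Disjoint y.1 y.2} ≤ N ^ (2 * t) := by
        refine (card_filter_le _ _).trans ?_
        rw [card_product, two_mul, pow_add]
        exact Nat.mul_le_mul (card_powersetCard_univ_le t) (card_powersetCard_univ_le t)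
      exact_mod_cast h1
  · refine (sum_le_card_nsmul _ _ ((N : ℝ) ^ s) fun y _ => hcardA _ _).trans ?_
    rw [nsmul_eq_mul]
    refine mul_le_mul_of_nonneg_right ?_ (by positivity)
    have h1 := card_filter_not_disjoint_product_le (V := V) ht ht
    rw [two_mul]
    exact_mod_cast h1

/-- Pairs `(A, B)` whose union is not in `Tr`: either `A` and `B` intersect, or `A ∪ B` is one of
the few missing sets, each of which has at most `2 ^ (s + t)` subsets `A`. -/
theorem card_filter_union_notMem_le {Tr : Finset (Finset V)} {s t : ℕ} (hs : s ≠ 0) (ht : t ≠ 0) :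
    #{x ∈ powersetCard s (univ : Finset V) ×ˢ powersetCard t (univ : Finset V) |
        x.1 ∪ x.2 ∉ Tr}
      ≤ Fintype.card V ^ (s + t - 1)
        + #(powersetCard (s + t) (univ : Finset V) \ Tr) * 2 ^ (s + t) := by
  set 𝒜 := powersetCard s (univ : Finset V)
  set 𝓑 := powersetCard t (univ : Finset V)
  set miss := powersetCard (s + t) (univ : Finset V) \ Tr with hmiss
  calc _ ≤ #({x ∈ 𝒜 ×ˢ 𝓑 | ¬ Disjoint x.1 x.2} ∪
          miss.biUnion fun g => g.powerset.image fun A => (A, g \ A)) := by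
        refine card_le_card fun x hx => ?_
        obtain ⟨h1, h2⟩ := mem_filter.1 hx
        obtain ⟨h3, h4⟩ := mem_product.1 h1
        by_cases hd : Disjoint x.1 x.2
        · refine mem_union_right _ (mem_biUnion.2 ⟨x.1 ∪ x.2, mem_sdiff.2
            ⟨mem_powersetCard.2 ⟨subset_univ _, ?_⟩, h2⟩, mem_image.2 ⟨x.1, ?_, ?_⟩⟩)
          · rw [card_union_of_disjoint hd, (mem_powersetCard.1 h3).2, (mem_powersetCard.1 h4).2]
          · exact mem_powerset.2 subset_union_left
          · rw [union_sdiff_cancel_left hd]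
        · exact mem_union_left _ (mem_filter.2 ⟨h1, hd⟩)
    _ ≤ _ := by
        refine (card_union_le _ _).trans (Nat.add_le_add
          (card_filter_not_disjoint_product_le hs ht) (card_biUnion_le_card_mul _ _ _ ?_))
        intro g hg
        refine card_image_le.trans ?_
        rw [card_powerset, (mem_powersetCard.1 (mem_sdiff.1 hg).1).2]

/-- In a nearly complete family `Tr` of coloured sets, an upper bound on the number `h` of members
that are guaranteed to differ in colour from any given one. Writing members as `A ∪ B`, two members
`A ∪ B` and `A' ∪ B'` of different colours yield, through `A ∪ B'`, either a missing set or a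
bichromatic triple. -/
theorem card_mul_le_of_coloring {H Tr : Finset (Finset V)} {r ℓ s t : ℕ}
    (hreg : ¬ HasRegularSubgraph H r) (hTr : (Tr : Set (Finset V)).Sized (s + t))
    (hs : ℓ < s) (ht : ℓ < t) (hr : r ≤ 2 ^ ℓ) {p : ℝ} (hp : 0 < p)
    (hdense : ((s + t : ℕ) + 1) * 16 ^ 2 ^ ℓ ≤ p ^ 2 ^ ℓ * Fintype.card V)
    {T' : Finset V} {col : Finset V → V}
    (hcol : ∀ g ∈ Tr, col g ∈ T' ∧ insert (col g) g ∈ H ∧ Disjoint g T') {h : ℝ}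
    (hh : ∀ x ∈ T', h ≤ #{g ∈ Tr | col g ≠ x}) (hh0 : 0 ≤ h) :
    #Tr * h ≤ ((Fintype.card V : ℝ) ^ (s + t - 1)
        + #(powersetCard (s + t) (univ : Finset V) \ Tr) * 2 ^ (s + t))
          * (Fintype.card V : ℝ) ^ (s + t)
      + 2 * ((Fintype.card V : ℝ) ^ (2 * (s + t)) * (#T' ^ 2 * p)
        + (Fintype.card V : ℝ) ^ (2 * (s + t) - 1)) := by
  set N := Fintype.card V with hN
  set 𝒜 := powersetCard s (univ : Finset V) with h𝒜
  set 𝓑 := powersetCard t (univ : Finset V) with h𝓑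
  have hs0 : s ≠ 0 := by omega
  have ht0 : t ≠ 0 := by omega
  have hdenseS : ∀ u : ℕ, u ≤ s + t →
      ((u : ℝ) + 1) * 16 ^ 2 ^ ℓ ≤ p ^ 2 ^ ℓ * Fintype.card V := fun u hu => by
    refine le_trans ?_ hdense
    have : (u : ℝ) ≤ (s + t : ℕ) := by exact_mod_cast hu
    gcongr
  set S := {x ∈ 𝒜 ×ˢ 𝓑 | x.1 ∪ x.2 ∈ Tr} with hS
  set S' := {x ∈ 𝒜 ×ˢ 𝓑 | x.1 ∪ x.2 ∉ Tr} with hS'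
  set R₁ := {x ∈ 𝒜 ×ˢ (𝓑 ×ˢ 𝓑) | x.1 ∪ x.2.1 ∈ Tr ∧ x.1 ∪ x.2.2 ∈ Tr ∧
    col (x.1 ∪ x.2.1) ≠ col (x.1 ∪ x.2.2)} with hR₁
  set R₂ := {x ∈ 𝓑 ×ˢ (𝒜 ×ˢ 𝒜) | x.1 ∪ x.2.1 ∈ Tr ∧ x.1 ∪ x.2.2 ∈ Tr ∧
    col (x.1 ∪ x.2.1) ≠ col (x.1 ∪ x.2.2)} with hR₂
  set Q := {x ∈ S ×ˢ S | col (x.2.1 ∪ x.2.2) ≠ col (x.1.1 ∪ x.1.2)} with hQ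
  have hsplit : ∀ g ∈ Tr, ∃ x ∈ S, x.1 ∪ x.2 = g := by
    intro g hg
    obtain ⟨A, hAg, hA⟩ := exists_subset_card_eq (show s ≤ #g by rw [hTr hg]; omega)
    refine ⟨(A, g \ A), mem_filter.2 ⟨mem_product.2 ⟨mem_powersetCard.2 ⟨subset_univ _, hA⟩,
      mem_powersetCard.2 ⟨subset_univ _, ?_⟩⟩, ?_⟩, ?_⟩
    · rw [card_sdiff_of_subset hAg, hTr hg, hA]
      omega
    · simpa [union_sdiff_of_subset hAg] using hg
    · exact union_sdiff_of_subset hAg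
  have hQlow : #Tr * h ≤ #Q := by
    have h1 : (#Tr : ℝ) ≤ #S := by
      have : #Tr ≤ #S := card_le_card_of_surjOn (fun x => x.1 ∪ x.2) fun g hg => by
        obtain ⟨x, hx, hxg⟩ := hsplit g hg
        exact ⟨x, hx, hxg⟩
      exact_mod_cast this
    have h2 : ∀ x ∈ S, h ≤ #{y ∈ S | col (y.1 ∪ y.2) ≠ col (x.1 ∪ x.2)} := by
      intro x hx
      refine (hh _ (hcol _ (mem_filter.1 hx).2).1).trans ?_
      norm_cast
      refine card_le_card_of_surjOn (fun y => y.1 ∪ y.2) fun g hg => ?_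
      obtain ⟨hg1, hg2⟩ := mem_filter.1 (mem_coe.1 hg)
      obtain ⟨y, hy, rfl⟩ := hsplit g hg1
      exact ⟨y, mem_coe.2 (mem_filter.2 ⟨hy, hg2⟩), rfl⟩
    have h3 : (#Q : ℝ) = ∑ x ∈ S, (#{y ∈ S | col (y.1 ∪ y.2) ≠ col (x.1 ∪ x.2)} : ℝ) := by
      rw [hQ, card_filter, sum_product]
      simp only [card_filter]
      push_cast
      rfl
    rw [h3]
    refine (mul_le_mul_of_nonneg_right h1 hh0).trans ?_
    rw [← nsmul_eq_mul]
    exact card_nsmul_le_sum _ _ _ h2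
  have hQsub : Q ⊆ {x ∈ Q | x.1.1 ∪ x.2.2 ∉ Tr} ∪
      {x ∈ Q | (x.1.1, (x.1.2, x.2.2)) ∈ R₁} ∪ {x ∈ Q | (x.2.2, (x.1.1, x.2.1)) ∈ R₂} := by
    intro x hx
    obtain ⟨h1, h2⟩ := mem_filter.1 hx
    obtain ⟨h3, h4⟩ := mem_product.1 h1
    obtain ⟨h5, h6⟩ := mem_filter.1 h3
    obtain ⟨h7, h8⟩ := mem_filter.1 h4
    rw [mem_product] at h5 h7
    simp only [mem_union, mem_filter, hx, true_and, hR₁, hR₂, mem_product, h5, h6, h7, h8,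
      union_comm x.2.2]
    by_cases hT : x.1.1 ∪ x.2.2 ∈ Tr
    · by_cases hc : col (x.1.1 ∪ x.1.2) = col (x.1.1 ∪ x.2.2)
      · right
        exact ⟨hT, fun h => h2 (by rw [← h, hc])⟩
      · left; right
        exact ⟨hT, hc⟩
    · left; left
      exact hT
  have hQmem : ∀ x ∈ Q, x.1.1 ∈ 𝒜 ∧ x.1.2 ∈ 𝓑 ∧ x.2.1 ∈ 𝒜 ∧ x.2.2 ∈ 𝓑 := by
    intro x hx
    obtain ⟨h3, h4⟩ := mem_product.1 (mem_filter.1 hx).1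
    obtain ⟨h5, h6⟩ := mem_product.1 (mem_filter.1 h3).1
    obtain ⟨h7, h8⟩ := mem_product.1 (mem_filter.1 h4).1
    exact ⟨h5, h6, h7, h8⟩
  have hc1 : #{x ∈ Q | x.1.1 ∪ x.2.2 ∉ Tr} ≤ #(S' ×ˢ (𝒜 ×ˢ 𝓑)) := by
    refine card_le_card_of_injOn (fun x => ((x.1.1, x.2.2), (x.2.1, x.1.2))) (fun x hx => ?_) ?_
    · obtain ⟨h1, h2⟩ := mem_filter.1 (mem_coe.1 hx)
      obtain ⟨h3, h4, h5, h6⟩ := hQmem x h1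
      simp [hS', h2, h3, h4, h5, h6]
    · rintro ⟨⟨a, b⟩, c, d⟩ - ⟨⟨a', b'⟩, c', d'⟩ - h
      simp only [Prod.mk.injEq] at h ⊢
      tauto
  have hc2 : #{x ∈ Q | (x.1.1, (x.1.2, x.2.2)) ∈ R₁} ≤ #(R₁ ×ˢ 𝒜) := by
    refine card_le_card_of_injOn (fun x => ((x.1.1, (x.1.2, x.2.2)), x.2.1)) (fun x hx => ?_) ?_
    · obtain ⟨h1, h2⟩ := mem_filter.1 (mem_coe.1 hx)
      exact mem_coe.2 (mem_product.2 ⟨h2, (hQmem x h1).2.2.1⟩)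
    · rintro ⟨⟨a, b⟩, c, d⟩ - ⟨⟨a', b'⟩, c', d'⟩ - h
      simp only [Prod.mk.injEq] at h ⊢
      tauto
  have hc3 : #{x ∈ Q | (x.2.2, (x.1.1, x.2.1)) ∈ R₂} ≤ #(R₂ ×ˢ 𝓑) := by
    refine card_le_card_of_injOn (fun x => ((x.2.2, (x.1.1, x.2.1)), x.1.2)) (fun x hx => ?_) ?_
    · obtain ⟨h1, h2⟩ := mem_filter.1 (mem_coe.1 hx)
      exact mem_coe.2 (mem_product.2 ⟨h2, (hQmem x h1).2.1⟩)
    · rintro ⟨⟨a, b⟩, c, d⟩ - ⟨⟨a', b'⟩, c', d'⟩ - h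
      simp only [Prod.mk.injEq] at h ⊢
      tauto
  have hQup : (#Q : ℝ) ≤ #S' * (#𝒜 * #𝓑) + #R₁ * #𝒜 + #R₂ * #𝓑 := by
    have h1 := (card_le_card hQsub).trans ((card_union_le _ _).trans
      (Nat.add_le_add_right (card_union_le _ _) _))
    simp only [card_product] at hc1 hc2 hc3
    exact_mod_cast h1.trans (Nat.add_le_add (Nat.add_le_add hc1 hc2) hc3)
  have hA : (#𝒜 : ℝ) ≤ (N : ℝ) ^ s := by exact_mod_cast card_powersetCard_univ_le s
  have hB : (#𝓑 : ℝ) ≤ (N : ℝ) ^ t := by exact_mod_cast card_powersetCard_univ_le t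
  have hS'card : (#S' : ℝ) ≤ (N : ℝ) ^ (s + t - 1)
      + #(powersetCard (s + t) (univ : Finset V) \ Tr) * 2 ^ (s + t) := by
    exact_mod_cast card_filter_union_notMem_le (Tr := Tr) hs0 ht0
  have hR₁card := card_bichromatic_triples_le hreg hTr hs ht0 hr hp (hdenseS s (by omega)) hcol
  have hR₂card := card_bichromatic_triples_le hreg (add_comm s t ▸ hTr) ht hs0 hr hp
    (hdenseS t (by omega)) hcol
  have hb1 : #R₁ * #𝒜 ≤ (N : ℝ) ^ (2 * (s + t)) * (#T' ^ 2 * p) + (N : ℝ) ^ (2 * (s + t) - 1) := by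
    refine (mul_le_mul hR₁card hA (Nat.cast_nonneg _) (by positivity)).trans (le_of_eq ?_)
    obtain ⟨j, rfl⟩ : ∃ j, t = j + 1 := ⟨t - 1, by omega⟩
    rw [show 2 * (j + 1) - 1 = 2 * j + 1 by omega, show 2 * (s + (j + 1)) - 1 = 2 * s + 2 * j + 1
      by omega]
    ring
  have hb2 : #R₂ * #𝓑 ≤ (N : ℝ) ^ (2 * (s + t)) * (#T' ^ 2 * p) + (N : ℝ) ^ (2 * (s + t) - 1) := by
    refine (mul_le_mul hR₂card hB (Nat.cast_nonneg _) (by positivity)).trans (le_of_eq ?_)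
    obtain ⟨j, rfl⟩ : ∃ j, s = j + 1 := ⟨s - 1, by omega⟩
    rw [show 2 * (j + 1) - 1 = 2 * j + 1 by omega, show 2 * (j + 1 + t) - 1 = 2 * t + 2 * j + 1
      by omega]
    ring
  have hb0 : #S' * (#𝒜 * #𝓑) ≤ ((N : ℝ) ^ (s + t - 1)
      + #(powersetCard (s + t) (univ : Finset V) \ Tr) * 2 ^ (s + t)) * (N : ℝ) ^ (s + t) := by
    rw [pow_add (N : ℝ) s t]
    gcongr
  linarith

end

/-! ### Exponents and the colour set -/

section

theorem pow_le_ceil_le {z : ℝ} (hz : 1 ≤ z) {c : ℝ} (hc : 1 ≤ c) (m : ℕ) :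
    c * z ^ m ≤ (⌈c * z ^ m⌉₊ : ℝ) ∧ (⌈c * z ^ m⌉₊ : ℝ) ≤ (c + 1) * z ^ m ∧ ⌈c * z ^ m⌉₊ ≠ 0 := by
  have h1 : (1 : ℝ) ≤ z ^ m := one_le_pow₀ hz
  have h2 : 0 < c * z ^ m := by positivity
  refine ⟨Nat.le_ceil _, ?_, (Nat.ceil_pos.2 h2).ne'⟩
  have := (Nat.ceil_lt_add_one h2.le).le
  linarith

section Exponents

variable {q k : ℕ} {z : ℝ}

/-- The condition `B * r < a * (M / 3) ^ (k - 2)` for matchings of edges meeting `T` once, where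
`B = |T| * n ^ (k - 1)` and `M` is about `z ^ (3 * q + 7)`. -/
theorem rainbow_matching_bound (hk : q + 3 ≤ k) (hz : 15 * (k : ℝ) + 3 ≤ z) {r : ℕ}
    (hr : r ≤ k) {M : ℝ} (hM : z ^ (3 * q + 7) ≤ M) :
    5 * z ^ ((q + 1) * (3 * q + 4)) * r * z ^ (2 * (q + 1)) < (M / 3) ^ (k - 2) := by
  have hk0 : (0 : ℝ) ≤ k := Nat.cast_nonneg k
  have hz1 : 1 ≤ z := by linarith
  have hz0 : 0 < z := by linarith
  have hM3 : z ^ (3 * q + 6) * (z / 3) ≤ M / 3 := by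
    have : z ^ (3 * q + 7) = z ^ (3 * q + 6) * z := by ring
    linarith
  have h1 : 1 ≤ z ^ (3 * q + 6) := one_le_pow₀ hz1
  have h2 : 1 ≤ z / 3 := by linarith
  have h3 : 1 ≤ M / 3 := by nlinarith
  calc 5 * z ^ ((q + 1) * (3 * q + 4)) * r * z ^ (2 * (q + 1))
      = z ^ ((3 * q + 6) * (q + 1)) * (5 * r) := by ring
    _ < z ^ ((3 * q + 6) * (q + 1)) * (z / 3) := by
        have : (r : ℝ) ≤ k := by exact_mod_cast hr
        have : 5 * (r : ℝ) < z / 3 := by linarith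
        gcongr
    _ ≤ z ^ ((3 * q + 6) * (q + 1)) * (z / 3) ^ (q + 1) := by
        have := le_self_pow₀ h2 (Nat.succ_ne_zero q)
        gcongr
    _ = (z ^ (3 * q + 6) * (z / 3)) ^ (q + 1) := by rw [mul_pow, ← pow_mul]
    _ ≤ (M / 3) ^ (q + 1) := pow_le_pow_left₀ (by positivity) hM3 _
    _ ≤ (M / 3) ^ (k - 2) := pow_le_pow_right₀ h3 (by omega)

/-- Few edges meet `T` once and also meet a matching of that size outside `T`. -/
theorem rainbow_deletion_bound (hq : 2 ≤ q) (hz1 : 1 ≤ z) (hz : 10 * (k : ℝ) ≤ z) :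
    k * (2 * z ^ (3 * q + 7)) * (5 * z ^ ((q + 1) * (3 * q + 4))) * z ^ (2 * (q + 1))
      ≤ z ^ (q * (q + 1) * (3 * q + 5)) := by
  calc _ = 10 * k * z ^ (3 * q + 7 + (q + 1) * (3 * q + 4) + 2 * (q + 1)) := by ring
    _ ≤ z * z ^ (3 * q + 7 + (q + 1) * (3 * q + 4) + 2 * (q + 1)) := by gcongr
    _ = z ^ (3 * q + 7 + (q + 1) * (3 * q + 4) + 2 * (q + 1) + 1) := (pow_succ' _ _).symm
    _ ≤ _ := by
        refine pow_le_pow_right₀ hz1 ?_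
        obtain ⟨u, rfl⟩ : ∃ u, q = u + 2 := ⟨q - 2, by omega⟩
        nlinarith [Nat.zero_le (u ^ 2), Nat.zero_le (u ^ 3)]

/-- A family of density `1 / (4 * z ^ (8 * q + 16))` is dense enough to contain `q` complementary
pairs. -/
theorem common_link_density_bound (hq : 2 ≤ q) (hk : 1 ≤ k) (hz : 64 * (k : ℝ) ≤ z) :
    k * 16 ^ q ≤ (1 / (4 * z ^ (8 * q + 16))) ^ q * z ^ (q * (q + 1) * (3 * q + 5)) := by
  have hk0 : (1 : ℝ) ≤ k := by exact_mod_cast hk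
  have hz1 : 1 ≤ z := by linarith
  have hz0 : 0 < z := by linarith
  rw [div_pow, one_pow, one_div, inv_mul_eq_div, le_div_iff₀ (by positivity), mul_pow, ← pow_mul]
  calc (k : ℝ) * 16 ^ q * (4 ^ q * z ^ ((8 * q + 16) * q))
      = k * (16 ^ q * 4 ^ q) * z ^ ((8 * q + 16) * q) := by ring
    _ ≤ k ^ q * (16 ^ q * 4 ^ q) * z ^ ((8 * q + 16) * q) := by
        have := le_self_pow₀ hk0 (show q ≠ 0 by omega)
        gcongr
    _ = (64 * k) ^ q * z ^ ((8 * q + 16) * q) := by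
        rw [← mul_pow, ← mul_pow]; norm_num [mul_comm]
    _ ≤ z ^ q * z ^ ((8 * q + 16) * q) := by gcongr
    _ = z ^ (q + (8 * q + 16) * q) := (pow_add _ _ _).symm
    _ ≤ _ := by
        refine pow_le_pow_right₀ hz1 ?_
        have : 8 * q + 17 ≤ (q + 1) * (3 * q + 5) := by nlinarith
        nlinarith

/-- The condition on `M` for matchings of edges avoiding `T`. For `k = q + 3` the exponents of `z`
on both sides agree. -/
theorem low_degree_matching_bound (hk : q + 3 ≤ k) (hz : 1 ≤ z) {M : ℝ}
    (hM : 3 * z ^ ((q + 1) * (3 * q + 2)) ≤ M) :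
    z ^ (q * (q + 1) * (3 * q + 5)) * z ^ (2 * (q + 1)) ≤ (M / 3) ^ (k - 2) := by
  have h1 : 1 ≤ z ^ ((q + 1) * (3 * q + 2)) := one_le_pow₀ hz
  have h2 : z ^ ((q + 1) * (3 * q + 2)) ≤ M / 3 := by linarith
  calc z ^ (q * (q + 1) * (3 * q + 5)) * z ^ (2 * (q + 1))
      = (z ^ ((q + 1) * (3 * q + 2))) ^ (q + 1) := by
        rw [← pow_mul, ← pow_add]
        congr 1
        ring
    _ ≤ (M / 3) ^ (q + 1) := pow_le_pow_left₀ (by positivity) h2 _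
    _ ≤ (M / 3) ^ (k - 2) := pow_le_pow_right₀ (by linarith) (by omega)

theorem high_degree_sq_bound (hq : 2 ≤ q) (hz : 1 ≤ z) :
    (z ^ ((q + 1) * (3 * q + 4))) ^ 2 * z ^ (2 * (q + 1)) ≤ z ^ (q * (q + 1) * (3 * q + 5)) := by
  rw [← pow_mul, ← pow_add]
  refine pow_le_pow_right₀ hz ?_
  calc (q + 1) * (3 * q + 4) * 2 + 2 * (q + 1) = 2 * (q + 1) * (3 * q + 5) := by ring
    _ ≤ q * (q + 1) * (3 * q + 5) := by gcongr

end Exponents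

section Hypergraph

variable {V : Type*} [Fintype V] {r k ℓ : ℕ} {z : ℝ}

/-- With `q = 2 ^ ℓ` and `|V| = z ^ (q (q + 1) (3 q + 5))`, the quantity
`|V| ^ (k - 1) / z ^ (2 (q + 1))` is the deficit `|V| ^ (k - 1 - 2δ)` that is allowed in the number
of edges, where `1 / q = α + δ`. -/
noncomputable def deficit (V : Type*) [Fintype V] (k ℓ : ℕ) (z : ℝ) : ℝ :=
  (Fintype.card V : ℝ) ^ (k - 1) / z ^ (2 * (2 ^ ℓ + 1))

/-- The upper bound `5 n ^ α` on the number of vertices of high degree. -/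
noncomputable def highDegreeBound (ℓ : ℕ) (z : ℝ) : ℝ := 5 * z ^ ((2 ^ ℓ + 1) * (3 * 2 ^ ℓ + 4))

theorem card_pos_of_eq_pow (hz : 1 ≤ z) {m : ℕ} (hN : (Fintype.card V : ℝ) = z ^ m) :
    (0 : ℝ) < Fintype.card V := by
  rw [hN]
  positivity

theorem sq_mul_pow_le_deficit (hℓ : ℓ ≠ 0) (hk : 2 ≤ k) (hz : 1 ≤ z)
    (hN : (Fintype.card V : ℝ) = z ^ (2 ^ ℓ * (2 ^ ℓ + 1) * (3 * 2 ^ ℓ + 5)))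
    {t : ℝ} (ht0 : 0 ≤ t) (ht : t ≤ highDegreeBound ℓ z) :
    t ^ 2 * (Fintype.card V : ℝ) ^ (k - 2) ≤ 25 * deficit V k ℓ z := by
  have h1 := high_degree_sq_bound (q := 2 ^ ℓ) (Nat.le_self_pow hℓ 2) hz
  rw [← hN] at h1
  unfold highDegreeBound at ht
  rw [deficit, ← mul_div_assoc, le_div_iff₀ (by positivity)]
  obtain ⟨j, rfl⟩ : ∃ j, k = j + 2 := ⟨k - 2, by omega⟩
  calc t ^ 2 * (Fintype.card V : ℝ) ^ (j + 2 - 2) * z ^ (2 * (2 ^ ℓ + 1))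
      ≤ (5 * z ^ ((2 ^ ℓ + 1) * (3 * 2 ^ ℓ + 4))) ^ 2 * (Fintype.card V : ℝ) ^ (j + 2 - 2)
        * z ^ (2 * (2 ^ ℓ + 1)) := by gcongr
    _ = 25 * (((z ^ ((2 ^ ℓ + 1) * (3 * 2 ^ ℓ + 4))) ^ 2 * z ^ (2 * (2 ^ ℓ + 1)))
        * (Fintype.card V : ℝ) ^ j) := by
        rw [Nat.add_sub_cancel]; ring
    _ ≤ 25 * (Fintype.card V * (Fintype.card V : ℝ) ^ j) := by gcongr
    _ = 25 * (Fintype.card V : ℝ) ^ (j + 2 - 1) := by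
        rw [show j + 2 - 1 = j + 1 by omega, pow_succ']

variable [DecidableEq V] {H : Finset (Finset V)}

/-- Few vertices `T'` of `T` meet almost all edges that meet `T` once. The bound on `|T'|` is stated
in the form in which pairs of vertices of `T'` are summed over. -/
theorem exists_colour_set (hreg : ¬ HasRegularSubgraph H r) (hH : (H : Set (Finset V)).Sized k)
    (hℓ : ℓ ≠ 0) (hk : 2 ^ ℓ + 3 ≤ k) (hr : r ≤ k) (hz : 64 * (k : ℝ) ≤ z)
    (hN : (Fintype.card V : ℝ) = z ^ (2 ^ ℓ * (2 ^ ℓ + 1) * (3 * 2 ^ ℓ + 5)))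
    {T : Finset V} (hT : #T ≤ highDegreeBound ℓ z) :
    ∃ T' ⊆ T, (#T' : ℝ) ^ 2 * (1 / (4 * z ^ (8 * 2 ^ ℓ + 16))) ≤ 1 / z ^ (2 * (2 ^ ℓ + 1)) ∧
      (#{e ∈ edgesMeetingOnce H T | Disjoint e T'} : ℝ) ≤ 2 * deficit V k ℓ z := by
  set q := 2 ^ ℓ with hq
  have hq2 : 2 ≤ q := by
    rw [hq]
    exact Nat.le_self_pow hℓ 2
  have hk3 : (3 : ℝ) ≤ k := by exact_mod_cast (show 3 ≤ k by omega)
  have hz1 : 1 ≤ z := by linarith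
  have hz0 : 0 < z := by linarith
  have hN0 := card_pos_of_eq_pow hz1 hN
  have hcp : (0 : ℝ) < z ^ (2 * (q + 1)) := by positivity
  obtain ⟨hM1, hM2, hM3⟩ := pow_le_ceil_le hz1 le_rfl (3 * q + 7)
  set M := ⌈1 * z ^ (3 * q + 7)⌉₊ with hM
  rw [one_mul] at hM1
  norm_num only at hM2
  have ha0 : 0 < deficit V k ℓ z := by
    unfold deficit
    positivity
  obtain ⟨T', hTT, hT'M, hT'⟩ := exists_small_subset_meeting_most_edges hreg hH (T := T)
    (by omega) hM3 ha0.le (by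
      have h1 := rainbow_matching_bound hk (by linarith) hr hM1
      rw [deficit, div_mul_eq_mul_div, lt_div_iff₀ hcp]
      have hT2 : #T * (Fintype.card V : ℝ) ^ (k - 1) * r * z ^ (2 * (q + 1))
          ≤ (5 * z ^ ((q + 1) * (3 * q + 4)) * r * z ^ (2 * (q + 1)))
            * (Fintype.card V : ℝ) ^ (k - 1) := by
        have h3 := hT
        unfold highDegreeBound at h3
        calc #T * (Fintype.card V : ℝ) ^ (k - 1) * r * z ^ (2 * (q + 1))
            ≤ (5 * z ^ ((q + 1) * (3 * q + 4))) * (Fintype.card V : ℝ) ^ (k - 1) * r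
              * z ^ (2 * (q + 1)) := by gcongr
          _ = _ := by ring
      refine hT2.trans_lt ?_
      rw [mul_comm]
      exact mul_lt_mul_of_pos_left h1 (by positivity)) (by
      have h1 := rainbow_deletion_bound hq2 hz1 (by linarith : 10 * (k : ℝ) ≤ z)
      rw [← hN] at h1
      rw [deficit, le_div_iff₀ hcp]
      obtain ⟨j, rfl⟩ : ∃ j, k = j + 2 := ⟨k - 2, by omega⟩
      have h3 := hT
      unfold highDegreeBound at h3
      calc ((j + 2 : ℕ) : ℝ) * M * (#T * (Fintype.card V : ℝ) ^ (j + 2 - 2)) * z ^ (2 * (q + 1))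
          ≤ ((j + 2 : ℕ) : ℝ) * (2 * z ^ (3 * q + 7)) * ((5 * z ^ ((q + 1) * (3 * q + 4)))
            * (Fintype.card V : ℝ) ^ (j + 2 - 2)) * z ^ (2 * (q + 1)) := by gcongr
        _ = (((j + 2 : ℕ) : ℝ) * (2 * z ^ (3 * q + 7)) * (5 * z ^ ((q + 1) * (3 * q + 4)))
            * z ^ (2 * (q + 1))) * (Fintype.card V : ℝ) ^ j := by
            rw [Nat.add_sub_cancel]; ring
        _ ≤ Fintype.card V * (Fintype.card V : ℝ) ^ j :=
            mul_le_mul_of_nonneg_right h1 (by positivity)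
        _ = (Fintype.card V : ℝ) ^ (j + 2 - 1) := by
            rw [show j + 2 - 1 = j + 1 by omega, pow_succ']
      )
  refine ⟨T', hTT, ?_, hT'⟩
  have h1 : (#T' : ℝ) ≤ 2 * z ^ (3 * q + 7) := le_trans (by exact_mod_cast hT'M) hM2
  calc (#T' : ℝ) ^ 2 * (1 / (4 * z ^ (8 * q + 16)))
      ≤ (2 * z ^ (3 * q + 7)) ^ 2 * (1 / (4 * z ^ (8 * q + 16))) := by gcongr
    _ = 1 / z ^ (2 * (q + 1)) := by
        rw [show 8 * q + 16 = 2 * (q + 1) + (3 * q + 7) * 2 by ring, pow_add]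
        field_simp
        ring

theorem card_edgesMeetingOnce_le_card_uniqueExtensionEdges_add
    (hreg : ¬ HasRegularSubgraph H r) (hH : (H : Set (Finset V)).Sized k)
    (hℓ : ℓ ≠ 0) (hk : 2 ^ ℓ + 3 ≤ k) (hr : r ≤ 2 ^ ℓ) (hz : 64 * (k : ℝ) ≤ z)
    (hN : (Fintype.card V : ℝ) = z ^ (2 ^ ℓ * (2 ^ ℓ + 1) * (3 * 2 ^ ℓ + 5)))
    {T : Finset V} (hT : #T ≤ highDegreeBound ℓ z) :
    (#(edgesMeetingOnce H T) : ℝ) ≤ #(uniqueExtensionEdges H T) + 5 * deficit V k ℓ z := by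
  obtain ⟨T', hTT, hT'1, hT'2⟩ := exists_colour_set hreg hH hℓ hk (by omega) hz hN hT
  have hk3 : (3 : ℝ) ≤ k := by exact_mod_cast (show 3 ≤ k by omega)
  have hz0 : 0 < z := by linarith
  have hℓk : ℓ < k - 1 := by
    have := Nat.lt_two_pow_self (n := ℓ)
    omega
  have h1 := card_edgesMeetingOnce_le hreg hH hℓk hr
    (p := 1 / (4 * z ^ (8 * 2 ^ ℓ + 16))) (by positivity)
    (by
      rw [hN]
      exact common_link_density_bound (Nat.le_self_pow hℓ 2) (by omega) hz) hTT hT'2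
  have h2 : (#T' : ℝ) ^ 2 * (1 / (4 * z ^ (8 * 2 ^ ℓ + 16)) * (Fintype.card V : ℝ) ^ (k - 1))
      ≤ deficit V k ℓ z := by
    rw [← mul_assoc, show deficit V k ℓ z
      = 1 / z ^ (2 * (2 ^ ℓ + 1)) * (Fintype.card V : ℝ) ^ (k - 1) by rw [deficit]; ring]
    exact mul_le_mul_of_nonneg_right hT'1 (by positivity)
  linarith

end Hypergraph

end

/-! ### Degrees, edge counts and stability -/

section

section Hypergraph

variable {V : Type*} [Fintype V] {r k ℓ : ℕ} {z : ℝ}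

theorem deficit_le (hz1 : 1 ≤ z) : deficit V k ℓ z ≤ (Fintype.card V : ℝ) ^ (k - 1) / z := by
  unfold deficit
  have : z ≤ z ^ (2 * (2 ^ ℓ + 1)) := le_self_pow₀ hz1 (by positivity)
  gcongr

theorem pow_le_deficit (hk : 2 ≤ k) (hz : 1 ≤ z)
    (hN : (Fintype.card V : ℝ) = z ^ (2 ^ ℓ * (2 ^ ℓ + 1) * (3 * 2 ^ ℓ + 5))) :
    (Fintype.card V : ℝ) ^ (k - 2) ≤ deficit V k ℓ z := by
  rw [deficit, le_div_iff₀ (by positivity)]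
  obtain ⟨j, rfl⟩ : ∃ j, k = j + 2 := ⟨k - 2, by omega⟩
  rw [show j + 2 - 1 = j + 1 by omega, Nat.add_sub_cancel, pow_succ]
  have : z ^ (2 * (2 ^ ℓ + 1)) ≤ Fintype.card V := by
    rw [hN]
    refine pow_le_pow_right₀ hz ?_
    have h1 : 1 ≤ 2 ^ ℓ := Nat.one_le_two_pow
    rw [mul_comm 2, mul_comm (2 ^ ℓ), mul_assoc]
    refine Nat.mul_le_mul_left _ ?_
    nlinarith
  gcongr

variable [DecidableEq V] {H : Finset (Finset V)}

theorem card_filter_disjoint_highDegreeSet_le (hreg : ¬ HasRegularSubgraph H r)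
    (hH : (H : Set (Finset V)).Sized k) (hk : 2 ^ ℓ + 3 ≤ k) (hr : r ≤ 2 ^ ℓ) (hz : 1 ≤ z)
    (hN : (Fintype.card V : ℝ) = z ^ (2 ^ ℓ * (2 ^ ℓ + 1) * (3 * 2 ^ ℓ + 5))) {D : ℝ}
    (hD : D = (Fintype.card V : ℝ) ^ (k - 1) / z ^ ((2 ^ ℓ + 1) * (3 * 2 ^ ℓ + 4))) :
    (#{e ∈ H | Disjoint e (highDegreeSet H D)} : ℝ) ≤ 5 * k * deficit V k ℓ z := by
  set q := 2 ^ ℓ with hq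
  have hz0 : 0 < z := by linarith
  have hN0 := card_pos_of_eq_pow hz hN
  obtain ⟨hM1, hM2, hM3⟩ := pow_le_ceil_le hz (by norm_num : (1 : ℝ) ≤ 3) ((q + 1) * (3 * q + 2))
  set M := ⌈3 * z ^ ((q + 1) * (3 * q + 2))⌉₊ with hM
  norm_num only at hM2
  have ha0 : 0 < deficit V k ℓ z := by
    unfold deficit
    positivity
  have hk0 : (0 : ℝ) < k := by exact_mod_cast (show 0 < k by omega)
  have hD0 : 0 ≤ D := by
    rw [hD]
    positivity
  have h1 := card_lt_of_degree_le (E := {e ∈ H | Disjoint e (highDegreeSet H D)}) hreg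
    (filter_subset _ _) hH (by omega) hM3 (D := D) (a := k * deficit V k ℓ z) (by positivity)
    (fun e he v hve => by
      have hv : v ∉ highDegreeSet H D := disjoint_left.1 (mem_filter.1 he).2 hve
      simp only [highDegreeSet, mem_filter, mem_univ, true_and, not_le] at hv
      refine le_trans ?_ hv.le
      exact_mod_cast card_le_card (filter_subset_filter _ (filter_subset _ _)))
    (by
      have h2 := low_degree_matching_bound (q := q) hk hz hM1
      rw [← hN] at h2
      have hrk : (r : ℝ) < k := by exact_mod_cast (show r < k by omega)
      calc (Fintype.card V : ℝ) ^ k * r < (Fintype.card V : ℝ) ^ k * k := by gcongr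
        _ = k * deficit V k ℓ z * (Fintype.card V * z ^ (2 * (q + 1))) := by
            obtain ⟨j, rfl⟩ : ∃ j, k = j + 1 := ⟨k - 1, by omega⟩
            rw [deficit, Nat.add_sub_cancel]
            field_simp
            rw [hq]
            ring
        _ ≤ _ := by gcongr)
    hD0
  have h2 : k * M * D ≤ 4 * k * deficit V k ℓ z := by
    calc k * M * D ≤ k * (4 * z ^ ((q + 1) * (3 * q + 2))) * D := by gcongr
      _ = 4 * k * deficit V k ℓ z := by
          rw [hD, deficit, show (q + 1) * (3 * q + 4) = (q + 1) * (3 * q + 2) + 2 * (q + 1) by ring,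
            pow_add]
          field_simp
          rw [hq]
  linarith

/-- The bound on the number of vertices of high degree. Otherwise some `T` of about `4 * n ^ α` of
them has degree sum at least `4 * n ^ (k - 1)`, although few edges meet `T` twice and at most about
`n ^ (k - 1)` meet it once. -/
theorem card_highDegreeSet_le (hreg : ¬ HasRegularSubgraph H r)
    (hH : (H : Set (Finset V)).Sized k) (hℓ : ℓ ≠ 0) (hk : 2 ^ ℓ + 3 ≤ k) (hr : r ≤ 2 ^ ℓ)
    (hz : 64 * (k : ℝ) ≤ z)
    (hN : (Fintype.card V : ℝ) = z ^ (2 ^ ℓ * (2 ^ ℓ + 1) * (3 * 2 ^ ℓ + 5))) {D : ℝ}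
    (hD : D = (Fintype.card V : ℝ) ^ (k - 1) / z ^ ((2 ^ ℓ + 1) * (3 * 2 ^ ℓ + 4))) :
    (#(highDegreeSet H D) : ℝ) ≤ highDegreeBound ℓ z := by
  by_contra! hlt
  have hk5 : (3 : ℝ) ≤ k := by exact_mod_cast (show 3 ≤ k by omega)
  have hz1 : 1 ≤ z := by linarith
  have hz0 : 0 < z := by linarith
  have hN0 := card_pos_of_eq_pow hz1 hN
  obtain ⟨hm1, hm2, -⟩ := pow_le_ceil_le hz1 (by norm_num : (1 : ℝ) ≤ 4)
    ((2 ^ ℓ + 1) * (3 * 2 ^ ℓ + 4))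
  set m := ⌈4 * z ^ ((2 ^ ℓ + 1) * (3 * 2 ^ ℓ + 4))⌉₊ with hm
  norm_num only at hm2
  have hmT : m ≤ #(highDegreeSet H D) := by
    unfold highDegreeBound at hlt
    exact_mod_cast hm2.trans hlt.le
  obtain ⟨T, hT, hTm⟩ := exists_subset_card_eq hmT
  have hTb : (#T : ℝ) ≤ highDegreeBound ℓ z := by
    rw [hTm]
    exact hm2
  have h1 := card_edgesMeetingOnce_le_card_uniqueExtensionEdges_add hreg hH hℓ hk hr hz hN hTb
  have h2 : (#(uniqueExtensionEdges H T) : ℝ) ≤ (Fintype.card V : ℝ) ^ (k - 1) := by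
    exact_mod_cast card_uniqueExtensionEdges_le hH T
  have h3 := sq_mul_pow_le_deficit hℓ (by omega : 2 ≤ k) hz1 hN (Nat.cast_nonneg _) hTb
  have h4 : (∑ x ∈ T, (degree H x : ℝ)) ≤ #(edgesMeetingOnce H T)
      + k * (#T ^ 2 * (Fintype.card V : ℝ) ^ (k - 2)) := by
    exact_mod_cast sum_degree_le hH T
  have h5 : 4 * (Fintype.card V : ℝ) ^ (k - 1) ≤ ∑ x ∈ T, (degree H x : ℝ) := by
    have h6 : #T • D ≤ ∑ x ∈ T, (degree H x : ℝ) := card_nsmul_le_sum _ _ _ fun x hx => by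
      have := hT hx
      simpa [highDegreeSet] using this
    refine le_trans ?_ h6
    rw [nsmul_eq_mul, hTm]
    calc 4 * (Fintype.card V : ℝ) ^ (k - 1)
        = 4 * z ^ ((2 ^ ℓ + 1) * (3 * 2 ^ ℓ + 4)) * D := by
          rw [hD]
          field_simp
      _ ≤ m * D := by
          have : 0 ≤ D := by rw [hD]; positivity
          gcongr
  have h7 := deficit_le (V := V) (k := k) (ℓ := ℓ) hz1
  set X := (Fintype.card V : ℝ) ^ (k - 1) with hX
  have hX0 : 0 < X := by positivity
  have h8 : X / z * (64 * k) ≤ X := by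
    rw [div_mul_eq_mul_div, div_le_iff₀ hz0]
    gcongr
  have h9 : k * (#T ^ 2 * (Fintype.card V : ℝ) ^ (k - 2)) ≤ k * (25 * (X / z)) := by
    have := h3.trans (mul_le_mul_of_nonneg_left h7 (by norm_num : (0 : ℝ) ≤ 25))
    gcongr
  have h10 : 0 ≤ X / z := by positivity
  nlinarith

theorem card_le_card_uniqueExtensionEdges_add (hreg : ¬ HasRegularSubgraph H r)
    (hH : (H : Set (Finset V)).Sized k) (hℓ : ℓ ≠ 0) (hk : 2 ^ ℓ + 3 ≤ k) (hr : r ≤ 2 ^ ℓ)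
    (hz : 64 * (k : ℝ) ≤ z)
    (hN : (Fintype.card V : ℝ) = z ^ (2 ^ ℓ * (2 ^ ℓ + 1) * (3 * 2 ^ ℓ + 5))) {D : ℝ}
    (hD : D = (Fintype.card V : ℝ) ^ (k - 1) / z ^ ((2 ^ ℓ + 1) * (3 * 2 ^ ℓ + 4))) :
    (#H : ℝ) ≤ #(uniqueExtensionEdges H (highDegreeSet H D))
      + (5 * k + 30) * deficit V k ℓ z := by
  have hk5 : (3 : ℝ) ≤ k := by exact_mod_cast (show 3 ≤ k by omega)
  have hz1 : 1 ≤ z := by linarith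
  have h1 := card_highDegreeSet_le hreg hH hℓ hk hr hz hN hD
  have h2 := card_filter_disjoint_highDegreeSet_le hreg hH hk hr hz1 hN hD
  have h3 := card_edgesMeetingOnce_le_card_uniqueExtensionEdges_add hreg hH hℓ hk hr hz hN h1
  have h4 := sq_mul_pow_le_deficit hℓ (by omega : 2 ≤ k) hz1 hN (Nat.cast_nonneg _) h1
  have h5 : (#H : ℝ) ≤ #{e ∈ H | Disjoint e (highDegreeSet H D)}
      + #(edgesMeetingOnce H (highDegreeSet H D))
      + #(highDegreeSet H D) ^ 2 * (Fintype.card V : ℝ) ^ (k - 2) := by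
    exact_mod_cast card_le_card_disjoint_add hH (highDegreeSet H D)
  linarith

/-- If no vertex dominates the unique-extension edges, the bound for nearly complete coloured
families yields an inequality between constants that depend on `k` only. -/
theorem coloring_inequality (hreg : ¬ HasRegularSubgraph H r)
    (hH : (H : Set (Finset V)).Sized k) (hℓ : ℓ ≠ 0) (hk : 2 ^ ℓ + 3 ≤ k) (hr : r ≤ 2 ^ ℓ)
    (hz : 64 * (k : ℝ) ≤ z)
    (hN : (Fintype.card V : ℝ) = z ^ (2 ^ ℓ * (2 ^ ℓ + 1) * (3 * 2 ^ ℓ + 5)))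
    {T : Finset V} (hT : #T ≤ highDegreeBound ℓ z) {c : ℝ}
    (hG : ((Fintype.card V).choose (k - 1) : ℝ) ≤ #(uniqueExtensionEdges H T)
      + c * deficit V k ℓ z) {h : ℝ} (hh0 : 0 ≤ h)
    (hh : ∀ v, degree (uniqueExtensionEdges H T) v + h + 2 * deficit V k ℓ z
      ≤ #(uniqueExtensionEdges H T)) :
    (#(uniqueExtensionEdges H T) - 2 * deficit V k ℓ z) * h
      ≤ (5 + 2 ^ (k - 1) * (c + 2)) * deficit V k ℓ z * (Fintype.card V : ℝ) ^ (k - 1) := by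
  set G := uniqueExtensionEdges H T with hGdef
  set a := deficit V k ℓ z with ha
  have hk5 : (3 : ℝ) ≤ k := by exact_mod_cast (show 3 ≤ k by omega)
  have hz1 : 1 ≤ z := by linarith
  have hz0 : 0 < z := by linarith
  have hN0 := card_pos_of_eq_pow hz1 hN
  obtain ⟨T', hTT, hT'1, hT'2⟩ := exists_colour_set hreg hH hℓ hk (by omega) hz hN hT
  set G₁ := {e ∈ G | ¬ Disjoint e T'} with hG₁
  set Tr := G₁.image (fun e => e \ T) with hTr
  have hGE : G ⊆ edgesMeetingOnce H T := filter_subset _ _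
  have hG₁card : (#G : ℝ) ≤ #G₁ + 2 * a := by
    have h1 : #{e ∈ G | Disjoint e T'} + #G₁ = #G := card_filter_add_card_filter_not _
    have h2 : (#{e ∈ G | Disjoint e T'} : ℝ) ≤ 2 * a := le_trans
      (by exact_mod_cast card_le_card (filter_subset_filter _ hGE)) hT'2
    have h1' : (#{e ∈ G | Disjoint e T'} : ℝ) + #G₁ = #G := by exact_mod_cast h1
    linarith
  have hTrcard : #Tr = #G₁ := card_image_of_injOn
    ((injOn_sdiff_uniqueExtensionEdges H T).mono (coe_subset.2 (filter_subset _ _)))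
  have hcolex : ∀ g ∈ Tr, ∃ x, x ∈ T' ∧ insert x g ∈ G ∧ Disjoint g T := by
    intro g hg
    obtain ⟨e, he, rfl⟩ := mem_image.1 hg
    obtain ⟨heG, heT⟩ := mem_filter.1 he
    obtain ⟨x, -, -, hex, hx⟩ := exists_mem_eq_insert_sdiff (hGE heG)
    obtain ⟨x', hx'e, hx'T⟩ := not_disjoint_iff.1 heT
    obtain rfl := hx x' hx'e (hTT hx'T)
    exact ⟨x', hx'T, hex ▸ heG, sdiff_disjoint⟩
  have : Nonempty V := Fintype.card_pos_iff.1 (by exact_mod_cast hN0)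
  choose! col hcolT hcolG hcolD using hcolex
  have hsized : ∀ g ∈ Tr, #g = k - 1 := by
    intro g hg
    obtain ⟨e, he, rfl⟩ := mem_image.1 hg
    exact card_sdiff_of_mem_edgesMeetingOnce hH (hGE (mem_filter.1 he).1)
  -- both parts of a trace have more than `ℓ` elements, as complementary pairs require
  obtain ⟨t, ht⟩ : ∃ t, k - 1 = ℓ + 1 + t := by
    have := Nat.lt_two_pow_self (n := ℓ)
    exact ⟨k - 1 - (ℓ + 1), by omega⟩
  have hℓt : ℓ < t := by
    have : 2 * ℓ ≤ 2 ^ ℓ := by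
      obtain ⟨m, rfl⟩ : ∃ m, ℓ = m + 1 := ⟨ℓ - 1, by omega⟩
      have := Nat.lt_two_pow_self (n := m)
      rw [pow_succ]
      omega
    omega
  have hclass : ∀ x ∈ T', h ≤ #{g ∈ Tr | col g ≠ x} := by
    intro x hx
    have h1 : #{g ∈ Tr | col g = x} ≤ degree G x := by
      refine card_le_card_of_injOn (insert x) (fun g hg => ?_) fun f hf g hg hfg => ?_
      · obtain ⟨h1, rfl⟩ := mem_filter.1 (mem_coe.1 hg)
        exact mem_coe.2 (mem_filter.2 ⟨hcolG g h1, mem_insert_self _ _⟩)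
      · have h1 := disjoint_right.1 (hcolD f (mem_filter.1 (mem_coe.1 hf)).1) (hTT hx)
        have h2 := disjoint_right.1 (hcolD g (mem_filter.1 (mem_coe.1 hg)).1) (hTT hx)
        rw [← erase_insert h1, ← erase_insert h2]
        exact congrArg (fun e => Finset.erase e x) hfg
    have h2 : #{g ∈ Tr | col g = x} + #{g ∈ Tr | col g ≠ x} = #Tr :=
      card_filter_add_card_filter_not _
    have h1' : (#{g ∈ Tr | col g = x} : ℝ) ≤ degree G x := by exact_mod_cast h1
    have h2' : (#{g ∈ Tr | col g = x} : ℝ) + #{g ∈ Tr | col g ≠ x} = #G₁ := by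
      rw [← hTrcard]
      exact_mod_cast h2
    have h3 := hh x
    linarith
  have hmain := card_mul_le_of_coloring hreg (Tr := Tr) (s := ℓ + 1) (t := t)
    (fun g hg => by rw [hsized g hg, ht]) (Nat.lt_succ_self ℓ) hℓt hr
    (p := 1 / (4 * z ^ (8 * 2 ^ ℓ + 16))) (by positivity) (by
      rw [← ht, hN, Nat.cast_sub (by omega), Nat.cast_one, sub_add_cancel]
      exact common_link_density_bound (Nat.le_self_pow hℓ 2) (by omega) hz)
    (T' := T') (col := col)
    (fun g hg => ⟨hcolT g hg, (mem_filter.1 (hGE (hcolG g hg))).1, (hcolD g hg).mono_right hTT⟩)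
    hclass hh0
  rw [← ht] at hmain
  have hmiss : (#(powersetCard (k - 1) (univ : Finset V) \ Tr) : ℝ) ≤ (c + 2) * a := by
    have hsub : Tr ⊆ powersetCard (k - 1) univ := fun g hg =>
      mem_powersetCard.2 ⟨subset_univ _, hsized g hg⟩
    rw [cast_card_sdiff hsub, card_powersetCard, card_univ, hTrcard]
    linarith
  have hNk := pow_le_deficit (by omega : 2 ≤ k) hz1 hN
  set X := (Fintype.card V : ℝ) ^ (k - 1) with hX
  have hX0 : 0 < X := by positivity
  have hX2 : (Fintype.card V : ℝ) ^ (2 * (k - 1)) = X * X := by rw [two_mul, pow_add]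
  have hX3 : (Fintype.card V : ℝ) ^ (2 * (k - 1) - 1) ≤ a * X := by
    rw [show 2 * (k - 1) - 1 = (k - 2) + (k - 1) by omega, pow_add]
    gcongr
  have hX4 : X * X * (#T' ^ 2 * (1 / (4 * z ^ (8 * 2 ^ ℓ + 16)))) ≤ a * X := by
    calc _ ≤ X * X * (1 / z ^ (2 * (2 ^ ℓ + 1))) := by gcongr
      _ = a * X := by rw [ha, deficit, ← hX]; ring
  have hX5 : ((Fintype.card V : ℝ) ^ (k - 1 - 1)
      + #(powersetCard (k - 1) (univ : Finset V) \ Tr) * 2 ^ (k - 1)) * X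
      ≤ (a + (c + 2) * a * 2 ^ (k - 1)) * X := by
    rw [show k - 1 - 1 = k - 2 by omega]
    gcongr
  rw [hX2, hTrcard] at hmain
  have hlast : (#G - 2 * a) * h ≤ #G₁ * h := mul_le_mul_of_nonneg_right (by linarith) hh0
  nlinarith

end Hypergraph

end

/-! ### Constants and the dominating vertex -/

section

theorem div_pow_le_choose {n k : ℕ} (hk : 1 ≤ k) (hn : 2 * k ≤ n) :
    (n : ℝ) ^ (k - 1) / (2 * k) ^ (k - 1) ≤ n.choose (k - 1) := by
  refine le_trans ?_ (Nat.pow_le_choose (k - 1) n)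
  have h1 : ((k - 1).factorial : ℝ) ≤ (k : ℝ) ^ (k - 1) := by
    exact_mod_cast (Nat.factorial_le_pow (k - 1)).trans (Nat.pow_le_pow_left (Nat.sub_le k 1) _)
  have h2 : (0 : ℝ) < (k - 1).factorial := by exact_mod_cast Nat.factorial_pos _
  have h3 : (n : ℝ) / 2 ≤ (n + 1 - (k - 1) : ℕ) := by
    have : n ≤ 2 * (n + 1 - (k - 1)) := by omega
    have : (n : ℝ) ≤ 2 * (n + 1 - (k - 1) : ℕ) := by exact_mod_cast this
    linarith
  calc (n : ℝ) ^ (k - 1) / (2 * k) ^ (k - 1) = (n / 2 : ℝ) ^ (k - 1) / k ^ (k - 1) := by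
        rw [mul_pow, div_pow, div_div]
    _ ≤ ((n + 1 - (k - 1) : ℕ) : ℝ) ^ (k - 1) / (k - 1).factorial := by gcongr

theorem five_mul_add_le_three_pow {k : ℕ} (hk : 5 ≤ k) : 5 * k + 40 ≤ 3 ^ k := by
  induction k, hk using Nat.le_induction with
  | base => norm_num
  | succ k hk ih =>
    rw [pow_succ]
    omega

/-- The factor `k ^ (4 * k)` in `β` outweighs the constants lost along the way. -/
theorem constant_bound {k : ℕ} (hk : 5 ≤ k) :
    (5 + 2 ^ (k - 1) * (5 * k + 34)) * ((2 * k) ^ k * (2 * k) ^ k) + 2 * (2 * k) ^ k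
      < k ^ (4 * k) := by
  set Y := (2 * k) ^ k with hY
  have hY1 : 1 ≤ Y := Nat.one_le_pow _ _ (by omega)
  have h1 : Y * Y * 6 ^ k ≤ k ^ (4 * k) := by
    calc Y * Y * 6 ^ k = (2 * k * (2 * k) * 6) ^ k := by rw [hY, ← mul_pow, ← mul_pow]
      _ ≤ (k ^ 4) ^ k := by
          refine Nat.pow_le_pow_left ?_ _
          have : 25 ≤ k ^ 2 := by nlinarith
          nlinarith [Nat.zero_le (k ^ 2)]
      _ = k ^ (4 * k) := (pow_mul _ _ _).symm
  have h2 := five_mul_add_le_three_pow hk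
  have h3 : 5 + 2 ^ (k - 1) * (5 * k + 34) + 2 < 6 ^ k := by
    have h4 : (2 * 3) ^ k = 2 ^ (k - 1) * 2 * 3 ^ k := by
      rw [← pow_succ, Nat.sub_add_cancel (by omega), ← mul_pow]
    have h5 : 1 ≤ 2 ^ (k - 1) := Nat.one_le_two_pow
    rw [show 6 = 2 * 3 from rfl, h4]
    nlinarith
  have hYY : Y ≤ Y * Y := Nat.le_mul_of_pos_left _ hY1
  have hYY0 : 0 < Y * Y := by positivity
  calc _ ≤ (5 + 2 ^ (k - 1) * (5 * k + 34) + 2) * (Y * Y) := by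
        rw [add_mul _ 2]
        omega
    _ < 6 ^ k * (Y * Y) := Nat.mul_lt_mul_of_pos_right h3 hYY0
    _ = Y * Y * 6 ^ k := mul_comm _ _
    _ ≤ _ := h1

section Exponents

variable {n ℓ : ℕ} {z : ℝ}

theorem pow_eq_rpow_of_eq_rpow
    (hz : z = (n : ℝ) ^ (1 / (2 ^ ℓ * (2 ^ ℓ + 1) * (3 * 2 ^ ℓ + 5)) : ℝ))
    (j : ℕ) : z ^ j = (n : ℝ) ^ (j / (2 ^ ℓ * (2 ^ ℓ + 1) * (3 * 2 ^ ℓ + 5)) : ℝ) := by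
  rw [hz, ← Real.rpow_natCast, ← Real.rpow_mul (Nat.cast_nonneg n)]
  congr 1
  ring

theorem threshold_eq (hz : z = (n : ℝ) ^ (1 / (2 ^ ℓ * (2 ^ ℓ + 1) * (3 * 2 ^ ℓ + 5)) : ℝ))
    (hn : 0 < n) {k : ℕ} (hk : 1 ≤ k) :
    threshold n k ℓ = (n : ℝ) ^ (k - 1) / z ^ ((2 ^ ℓ + 1) * (3 * 2 ^ ℓ + 4)) := by
  rw [pow_eq_rpow_of_eq_rpow hz, threshold, Real.rpow_sub (by exact_mod_cast hn),
    ← Real.rpow_natCast, Nat.cast_sub hk, Nat.cast_one, alpha]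
  congr 2
  push_cast
  field_simp

theorem beta_eq (hz : z = (n : ℝ) ^ (1 / (2 ^ ℓ * (2 ^ ℓ + 1) * (3 * 2 ^ ℓ + 5)) : ℝ)) (k : ℕ) :
    beta n k ℓ = (k : ℝ) ^ (4 * k) / z ^ (2 * (2 ^ ℓ + 1)) := by
  rw [pow_eq_rpow_of_eq_rpow hz, beta, Real.rpow_neg (Nat.cast_nonneg n), ← div_eq_mul_inv]
  congr 2
  rw [zpow_sub_one₀ two_ne_zero, zpow_natCast]
  push_cast
  field_simp

end Exponents

theorem le_two_pow_of_eq_ceil {r ℓ : ℕ} (hr : 1 ≤ r) (hℓ : (ℓ : ℤ) = ⌈Real.logb 2 (r : ℝ)⌉) :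
    r ≤ 2 ^ ℓ := by
  have h1 : Real.logb 2 r ≤ ℓ := by
    have := Int.le_ceil (Real.logb 2 (r : ℝ))
    rw [← hℓ] at this
    exact_mod_cast this
  rw [Real.logb_le_iff_le_rpow one_lt_two (by exact_mod_cast hr), Real.rpow_natCast] at h1
  exact_mod_cast h1

theorem hasRegularSubgraph_one {V : Type*} [Fintype V] [DecidableEq V] {H : Finset (Finset V)}
    {e : Finset V} (he : e ∈ H) (hne : e.Nonempty) : HasRegularSubgraph H 1 :=
  ⟨{e}, singleton_subset_iff.2 he, e, hne, fun v hv => by simp [degree, filter_singleton, hv],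
    fun v hv => by simp [degree, filter_singleton, hv]⟩

/-- The theorem for `r ≥ 2`, in terms of `z = n ^ (1 / (q (q + 1) (3 q + 5)))`, `q = 2 ^ ℓ`. -/
theorem exists_dominating_vertex {V : Type*} [Fintype V] [DecidableEq V] {H : Finset (Finset V)}
    {r k ℓ : ℕ} {z : ℝ} (hreg : ¬ HasRegularSubgraph H r) (hH : (H : Set (Finset V)).Sized k)
    (hℓ : ℓ ≠ 0) (hk : 2 ^ ℓ + 3 ≤ k) (hr : r ≤ 2 ^ ℓ) (hz : 64 * (k : ℝ) * (2 * k) ^ k ≤ z)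
    (hN : (Fintype.card V : ℝ) = z ^ (2 ^ ℓ * (2 ^ ℓ + 1) * (3 * 2 ^ ℓ + 5))) {D β : ℝ}
    (hD : D = (Fintype.card V : ℝ) ^ (k - 1) / z ^ ((2 ^ ℓ + 1) * (3 * 2 ^ ℓ + 4)))
    (hβ : β = (k : ℝ) ^ (4 * k) / z ^ (2 * (2 ^ ℓ + 1)))
    (hcard : ((Fintype.card V - 1).choose (k - 1) : ℝ) - deficit V k ℓ z ≤ #H) :
    ∃ v : V, (1 - β) * #(uniqueExtensionEdges H (highDegreeSet H D))
      ≤ degree (uniqueExtensionEdges H (highDegreeSet H D)) v := by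
  by_contra! hcon
  set T := highDegreeSet H D with hT
  set G := uniqueExtensionEdges H T with hG
  set a := deficit V k ℓ z with ha
  set N := Fintype.card V with hNdef
  have h2ℓ : 2 ≤ 2 ^ ℓ := Nat.le_self_pow hℓ 2
  have hk5 : (5 : ℝ) ≤ k := by exact_mod_cast (show 5 ≤ k by omega)
  set Y : ℝ := (2 * k) ^ k with hY
  have hY1 : 1 ≤ Y := one_le_pow₀ (by linarith)
  have hz64 : 64 * (k : ℝ) ≤ z := by nlinarith
  have hz1 : 1 ≤ z := by linarith
  have hz0 : 0 < z := by linarith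
  have hN0 : (0 : ℝ) < N := card_pos_of_eq_pow hz1 hN
  set X : ℝ := (N : ℝ) ^ (k - 1) with hX
  have hX0 : 0 < X := by positivity
  have ha0 : 0 < a := by
    rw [ha, deficit]
    positivity
  have hkN : 2 * k ≤ N := by
    have h1 : z ≤ N := by
      rw [hN]
      exact le_self_pow₀ hz1 (by positivity)
    have h2 : (2 * k : ℝ) ≤ N := by linarith
    exact_mod_cast h2
  have h1 := card_le_card_uniqueExtensionEdges_add hreg hH hℓ hk hr hz64 hN hD
  have hTcard := card_highDegreeSet_le hreg hH hℓ hk hr hz64 hN hD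
  have hGcard : (N.choose (k - 1) : ℝ) ≤ #G + (5 * k + 32) * a := by
    have h2 : N.choose (k - 1) ≤ N ^ (k - 2) + (N - 1).choose (k - 1) := by
      obtain ⟨j, hj⟩ : ∃ j, k = j + 2 := ⟨k - 2, by omega⟩
      obtain ⟨m, hm⟩ : ∃ m, N = m + 1 := ⟨N - 1, by omega⟩
      rw [hm, hj, show j + 2 - 1 = j + 1 by omega, Nat.choose_succ_succ, Nat.add_sub_cancel,
        Nat.add_sub_cancel]
      gcongr
      exact (Nat.choose_le_pow m j).trans (Nat.pow_le_pow_left (Nat.le_succ m) j)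
    have h3 := pow_le_deficit (V := V) (by omega : 2 ≤ k) hz1 hN
    have h2' : (N.choose (k - 1) : ℝ) ≤ (N : ℝ) ^ (k - 2) + (N - 1).choose (k - 1) := by
      exact_mod_cast h2
    linarith
  -- the number of unique-extension edges is of order `n ^ (k - 1)`
  have hGlow : X / Y ≤ #G - 2 * a := by
    have h2 := div_pow_le_choose (by omega : 1 ≤ k) hkN
    have h3 : (5 * k + 34) * a ≤ X / Y := by
      have h4 : a ≤ X / z := deficit_le hz1
      calc (5 * k + 34) * a ≤ (64 * k) * (X / z) := by
            gcongr
            linarith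
        _ ≤ X / Y := by
            rw [mul_div_assoc', div_le_div_iff₀ hz0 (by positivity)]
            calc 64 * k * X * Y = (64 * k * Y) * X := by ring
              _ ≤ z * X := by gcongr
              _ = X * z := mul_comm _ _
    have h5 : 2 * (X / Y) ≤ X / (2 * k) ^ (k - 1) := by
      have h6 : Y = (2 * k) ^ (k - 1) * (2 * k) := by
        rw [← pow_succ, Nat.sub_add_cancel (by omega)]
      have h7 : 0 < X / (2 * (k : ℝ)) ^ (k - 1) := by positivity
      rw [h6, ← div_div, mul_div_assoc', div_le_iff₀ (by positivity)]
      nlinarith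
    linarith
  have hconst : (5 + 2 ^ (k - 1) * (5 * (k : ℝ) + 34)) * (Y * Y) + 2 * Y < (k : ℝ) ^ (4 * k) := by
    have h2 := Nat.cast_lt (α := ℝ).2 (constant_bound (by omega : 5 ≤ k))
    push_cast at h2
    rw [hY]
    exact h2
  have hY0 : 0 < Y := by linarith
  have hKY : 5 + 2 ^ (k - 1) * (5 * (k : ℝ) + 34) < ((k : ℝ) ^ (4 * k) / Y - 2) / Y := by
    rw [lt_div_iff₀ hY0, lt_sub_iff_add_lt, lt_div_iff₀ hY0]
    linarith
  have hC0 : (0 : ℝ) ≤ 5 + 2 ^ (k - 1) * (5 * (k : ℝ) + 34) := by positivity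
  have hh0 : 0 ≤ ((k : ℝ) ^ (4 * k) / Y - 2) * a := by
    have h2 : 0 < ((k : ℝ) ^ (4 * k) / Y - 2) / Y := by linarith
    have h3 : 0 < (k : ℝ) ^ (4 * k) / Y - 2 := by
      by_contra! h4
      exact absurd h2 (not_lt.2 (div_nonpos_of_nonpos_of_nonneg h4 hY0.le))
    positivity
  have hmain := coloring_inequality hreg hH hℓ hk hr hz64 hN hTcard hGcard hh0 (fun v => by
    have h2 := hcon v
    have h3 : (k : ℝ) ^ (4 * k) / Y * a ≤ β * #G := by
      calc (k : ℝ) ^ (4 * k) / Y * a = β * (X / Y) := by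
            rw [hβ, ha, deficit]
            ring
        _ ≤ β * #G := by
            have : 0 ≤ β := by rw [hβ]; positivity
            gcongr
            linarith
    linarith)
  have h2 : X / Y * (((k : ℝ) ^ (4 * k) / Y - 2) * a)
      ≤ (5 + 2 ^ (k - 1) * (5 * k + 32 + 2)) * a * X :=
    (mul_le_mul_of_nonneg_right hGlow hh0).trans hmain
  have h3 : ((k : ℝ) ^ (4 * k) / Y - 2) / Y * (a * X)
      ≤ (5 + 2 ^ (k - 1) * (5 * (k : ℝ) + 34)) * (a * X) := by
    calc _ = X / Y * (((k : ℝ) ^ (4 * k) / Y - 2) * a) := by ring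
      _ ≤ _ := h2
      _ = _ := by ring
  exact absurd (le_of_mul_le_mul_right h3 (by positivity)) (not_le.2 hKY)

end

end RegularSubgraph

theorem theorem4p1 (k : ℕ) :
    ∃ n_k : ℕ, ∀ (r ℓ : ℕ), 1 ≤ r → (ℓ : ℤ) = ⌈Real.logb 2 (r : ℝ)⌉ → 2 ^ ℓ + 3 ≤ k →
      ∀ n : ℕ, n_k ≤ n →
      ∀ (V : Type*) [Fintype V] [DecidableEq V], Fintype.card V = n →
      ∀ H : Finset (Finset V), (H : Set (Finset V)).Sized k →
        ¬ RegularSubgraph.HasRegularSubgraph H r →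
        ((n - 1).choose (k - 1) : ℝ) -
            RegularSubgraph.beta n k ℓ * (n : ℝ) ^ (k - 1) / (k : ℝ) ^ (4 * k) ≤ (H.card : ℝ) →
        ∃ v : V,
          (1 - RegularSubgraph.beta n k ℓ) *
              ((RegularSubgraph.uniqueExtensionTraces H
                (RegularSubgraph.highDegreeSet H
                  (RegularSubgraph.threshold n k ℓ))).card : ℝ) ≤
            ((RegularSubgraph.link
              (RegularSubgraph.uniqueExtensionEdges H
                (RegularSubgraph.highDegreeSet H
                  (RegularSubgraph.threshold n k ℓ))) v).card : ℝ) := by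
  refine ⟨(64 * k * (2 * k) ^ k) ^ (k * (k + 1) * (3 * k + 5)), ?_⟩
  intro r ℓ hr hℓr hk n hn V _ _ hV H hH hreg hcard
  have hrℓ := RegularSubgraph.le_two_pow_of_eq_ceil hr hℓr
  have hn0 : 0 < n := lt_of_lt_of_le (by
    have : 0 < k := by omega
    positivity) hn
  obtain rfl | hℓ := eq_or_ne ℓ 0
  · -- a single edge is a `1`-regular subgraph, so `H` has no edges
    obtain rfl : r = 1 := by omega
    have hH0 : H = ∅ := Finset.eq_empty_of_forall_notMem fun e he =>
      hreg (RegularSubgraph.hasRegularSubgraph_one he (Finset.card_pos.1 (by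
        have := hH he
        omega)))
    obtain ⟨v⟩ : Nonempty V := Fintype.card_pos_iff.1 (hV ▸ hn0)
    refine ⟨v, ?_⟩
    simp [hH0, RegularSubgraph.uniqueExtensionTraces, RegularSubgraph.uniqueExtensionEdges,
      RegularSubgraph.edgesMeetingOnce]
  · subst hV
    set z : ℝ := (Fintype.card V : ℝ) ^ (1 / (2 ^ ℓ * (2 ^ ℓ + 1) * (3 * 2 ^ ℓ + 5)) : ℝ) with hz
    have hzpow : (Fintype.card V : ℝ) = z ^ (2 ^ ℓ * (2 ^ ℓ + 1) * (3 * 2 ^ ℓ + 5)) := by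
      rw [RegularSubgraph.pow_eq_rpow_of_eq_rpow hz]
      push_cast
      rw [div_self (by positivity), Real.rpow_one]
    have hz0 : 0 ≤ z := Real.rpow_nonneg (Nat.cast_nonneg _) _
    have hZ : 64 * (k : ℝ) * (2 * k) ^ k ≤ z := by
      refine le_of_pow_le_pow_left₀ (n := 2 ^ ℓ * (2 ^ ℓ + 1) * (3 * 2 ^ ℓ + 5))
        (by positivity) hz0 ?_
      rw [← hzpow]
      have h1 : (64 * k * (2 * k) ^ k) ^ (2 ^ ℓ * (2 ^ ℓ + 1) * (3 * 2 ^ ℓ + 5))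
          ≤ Fintype.card V := by
        refine le_trans (Nat.pow_le_pow_right ?_ ?_) hn
        · have : 0 < k := by omega
          positivity
        · have : 2 ^ ℓ ≤ k := by omega
          gcongr
      exact_mod_cast h1
    have hβ := RegularSubgraph.beta_eq hz k
    obtain ⟨v, hv⟩ := RegularSubgraph.exists_dominating_vertex hreg hH hℓ hk hrℓ hZ hzpow
      (RegularSubgraph.threshold_eq hz hn0 (by omega)) hβ (by
        refine le_trans (le_of_eq ?_) hcard
        have : (k : ℝ) ≠ 0 := by
          have : k ≠ 0 := by omega
          exact_mod_cast this
        rw [hβ, RegularSubgraph.deficit]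
        field_simp)
    refine ⟨v, ?_⟩
    rwa [RegularSubgraph.card_uniqueExtensionTraces, RegularSubgraph.card_link]
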